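/- Let $m\ge 1$, $n=2m+1$, $\lambda=e^{2\pi i/n}$, and let $I_2(n)$ be the dihedral group of order $2n$, with rotations $S_k$ and reflections $R_k$ ($k\in\mathbb Z/n\mathbb Z$) satisfying $R_kR_l=S_{k-l}$, $S_kS_l=S_{k+l}$, $R_kS_l=R_{k-l}$, $S_kR_l=R_{k+l}$. For $p\in\mathbb Z/n\mathbb Z$ put $L_p=\frac1n\sum_k\lambda^{kp}R_k$ and $Q_p=\frac1n\sum_k\lambda^{-kp}S_k$ in $\mathbb C[I_2(n)]$. For $\nu\in\mathbb C$ and $\mu=n\nu$, the symplectic reflection algebra $\mathcal H=H_{1,\nu}(I_2(n))$ is the associative unital algebra generated by $\mathbb C[I_2(n)]$ and elements $a^\alpha,b^\alpha$ ($\alpha=0,1$) with the relations $$L_pa^\alpha=-b^\alpha L_{p+1},\quad L_pb^\alpha=-a^\alpha L_{p-1},\quad Q_pa^\alpha=a^\alpha Q_{p+1},\quad Q_pb^\alpha=b^\alpha Q_{p-1},$$ $$[a^\alpha,b^\beta]=\varepsilon^{\alpha\beta}(1+\mu L_0),\quad [a^\alpha,a^\beta]=\varepsilon^{\alpha\beta}\mu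 L_1,\quad [b^\alpha,b^\beta]=\varepsilon^{\alpha\beta}\mu L_{-1},$$ where $\varepsilon^{\alpha\beta}$ is skew-symmetric with $\varepsilon^{01}=1$. It is $\mathbb Z_2$-graded with $a^\alpha,b^\alpha$ odd and $I_2(n)$ even; write $\varepsilon(f)$ for the parity of a homogeneous element $f$. A trace on $\mathcal H$ is a linear function $tr:\mathcal H\to\mathbb C$ with $tr(fg-gf)=0$ for all $f,g$; a supertrace is a linear function $str:\mathcal H\to\mathbb C$ with $str(fg-(-1)^{\varepsilon(f)\varepsilon(g)}gf)=0$ for all homogeneous $f,g$. **Theorem.** Let $z\in\mathbb Z\setminus n\mathbb Z$ and $\nu=z/n$, and let $\tau,\tau'\in\mathbb C\setminus\{0\}$. Let $tr_z$ be a trace on $\mathcal H$ with $$tr_z(S_k)=\frac{\tau}{n\sin^2\frac{\pi k}{n}}\Bigl(1-\cos\frac{2\pi kz}{n}\Bigr),\qquad k=1,\dots,m,$$ and let $str_z$ be a supertrace on $\mathcal H$ with $$str_z(S_k)=\frac{\tau'}{n\cos^2\frac{\pi k}{n}}\Bigl(1-(-1)^z\cos\frac{2\pi kz}{n}\Bigr),\qquad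 k=0,\dots,m.$$ Then the kernels of the bilinear forms $B_{tr_z}(x,y)=tr_z(xy)$ and $B_{str_z}(x,y)=str_z(xy)$ coincide, and they are one and the same two-sided ideal of $\mathcal H$: $$\{x\in\mathcal H: tr_z(xy)=0\ \forall y\in\mathcal H\}=\{x\in\mathcal H: str_z(xy)=0\ \forall y\in\mathcal H\}.$$ -/

import Mathlib

/-!
The symplectic reflection algebra `H_{1,ν}(I₂(2m+1))`, its parity, its traces and supertraces,
and the kernels of the associated bilinear forms.
-/

namespace DihedralSRA

/-- Generators of the algebra: `a^α`, `b^α` (`α = 0, 1`) and the elements of the group `I₂(n)`. -/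
inductive Gen (n : ℕ) : Type
  | a (α : Fin 2) : Gen n
  | b (α : Fin 2) : Gen n
  | grp (g : DihedralGroup n) : Gen n

/-- The rotation `S_k` of the regular `n`-gon. -/
def rot (n : ℕ) (k : ZMod n) : DihedralGroup n := DihedralGroup.r k

/-- The reflection `R_k`. With this indexing `R_k R_l = S_{k-l}`, `S_k S_l = S_{k+l}`,
`R_k S_l = R_{k-l}` and `S_k R_l = R_{k+l}`. -/
def reflec (n : ℕ) (k : ZMod n) : DihedralGroup n := DihedralGroup.sr (-k)

theorem reflec_mul_reflec (n : ℕ) (k l : ZMod n) : reflec n k * reflec n l = rot n (k - l) := by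
  simp only [reflec, rot, DihedralGroup.sr_mul_sr]
  congr 1
  ring

theorem rot_mul_rot (n : ℕ) (k l : ZMod n) : rot n k * rot n l = rot n (k + l) := by
  simp only [rot, DihedralGroup.r_mul_r]

theorem reflec_mul_rot (n : ℕ) (k l : ZMod n) : reflec n k * rot n l = reflec n (k - l) := by
  simp only [reflec, rot, DihedralGroup.sr_mul_r]
  congr 1
  ring

theorem rot_mul_reflec (n : ℕ) (k l : ZMod n) : rot n k * reflec n l = reflec n (k + l) := by
  simp only [reflec, rot, DihedralGroup.r_mul_sr]
  congr 1
  ring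

/-- The skew-symmetric tensor with `ε^{01} = 1`. -/
def eps (α β : Fin 2) : ℂ := !![0, 1; -1, 0] α β

noncomputable section

/-- The free associative unital algebra on the generators. -/
abbrev Free (n : ℕ) : Type := FreeAlgebra ℂ (Gen n)

def fa (n : ℕ) (α : Fin 2) : Free n := FreeAlgebra.ι ℂ (Gen.a α)

def fb (n : ℕ) (α : Fin 2) : Free n := FreeAlgebra.ι ℂ (Gen.b α)

def fg {n : ℕ} (g : DihedralGroup n) : Free n := FreeAlgebra.ι ℂ (Gen.grp g)

/-- `L_p = (1/n) ∑_k λ^{kp} R_k` with `λ = exp (2πi/n)`; here `ZMod.stdAddChar j = λ^j`. -/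
def fL (n : ℕ) [NeZero n] (p : ZMod n) : Free n :=
  (1 / (n : ℂ)) • ∑ k : ZMod n, (ZMod.stdAddChar (k * p) : ℂ) • fg (reflec n k)

/-- `Q_p = (1/n) ∑_k λ^{-kp} S_k`. -/
def fQ (n : ℕ) [NeZero n] (p : ZMod n) : Free n :=
  (1 / (n : ℂ)) • ∑ k : ZMod n, (ZMod.stdAddChar (-(k * p)) : ℂ) • fg (rot n k)

/-- The defining relations, with `μ = n ν`. The relations between the `L_p` and `Q_p` themselves
are those of the group algebra and are imposed through the multiplication of the group. -/
inductive Rel (n : ℕ) [NeZero n] (ν : ℂ) : Free n → Free n → Prop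
  | grp_one : Rel n ν (fg 1) 1
  | grp_mul (g h : DihedralGroup n) : Rel n ν (fg g * fg h) (fg (g * h))
  | L_a (p : ZMod n) (α : Fin 2) : Rel n ν (fL n p * fa n α) (-(fb n α * fL n (p + 1)))
  | L_b (p : ZMod n) (α : Fin 2) : Rel n ν (fL n p * fb n α) (-(fa n α * fL n (p - 1)))
  | Q_a (p : ZMod n) (α : Fin 2) : Rel n ν (fQ n p * fa n α) (fa n α * fQ n (p + 1))
  | Q_b (p : ZMod n) (α : Fin 2) : Rel n ν (fQ n p * fb n α) (fb n α * fQ n (p - 1))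
  | comm_ab (α β : Fin 2) : Rel n ν (fa n α * fb n β - fb n β * fa n α)
      (eps α β • (1 + ((n : ℂ) * ν) • fL n 0))
  | comm_aa (α β : Fin 2) : Rel n ν (fa n α * fa n β - fa n β * fa n α)
      (eps α β • (((n : ℂ) * ν) • fL n 1))
  | comm_bb (α β : Fin 2) : Rel n ν (fb n α * fb n β - fb n β * fb n α)
      (eps α β • (((n : ℂ) * ν) • fL n (-1)))

/-- The symplectic reflection algebra `H_{1,ν}(I₂(n))` (used for odd `n`). -/
abbrev SRA (n : ℕ) [NeZero n] (ν : ℂ) : Type := RingQuot (Rel n ν)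

variable {n : ℕ} [NeZero n] {ν : ℂ}

/-- The image of a generator in the algebra. -/
def gen (n : ℕ) [NeZero n] (ν : ℂ) (x : Gen n) : SRA n ν :=
  RingQuot.mkAlgHom ℂ (Rel n ν) (FreeAlgebra.ι ℂ x)

/-- The rotation `S_k` as an element of the algebra. -/
def S (n : ℕ) [NeZero n] (ν : ℂ) (k : ZMod n) : SRA n ν := gen n ν (Gen.grp (rot n k))

/-- Parity of the generators: `a^α`, `b^α` are odd, group elements are even. -/
def Gen.parity {n : ℕ} : Gen n → ZMod 2
  | Gen.a _ => 1
  | Gen.b _ => 1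
  | Gen.grp _ => 0

/-- The homogeneous component of parity `i`: the span of the words of parity `i`. -/
def parityPart (n : ℕ) [NeZero n] (ν : ℂ) (i : ZMod 2) : Submodule ℂ (SRA n ν) :=
  Submodule.span ℂ {x | ∃ w : List (Gen n), (w.map Gen.parity).sum = i ∧
    x = (w.map (gen n ν)).prod}

/-- `tr (f g - g f) = 0` for all `f`, `g`. -/
def IsTrace (tr : SRA n ν →ₗ[ℂ] ℂ) : Prop :=
  ∀ f g : SRA n ν, tr (f * g - g * f) = 0

/-- `str (f g - (-1)^{ε(f) ε(g)} g f) = 0` for all homogeneous `f`, `g`. -/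
def IsSupertrace (str : SRA n ν →ₗ[ℂ] ℂ) : Prop :=
  ∀ i j : ZMod 2, ∀ f ∈ parityPart n ν i, ∀ g ∈ parityPart n ν j,
    str (f * g - ((-1 : ℂ) ^ (i.val * j.val)) • (g * f)) = 0

/-- The bilinear form `B_sp(x, y) = sp (x y)`. -/
def form (sp : SRA n ν →ₗ[ℂ] ℂ) : SRA n ν →ₗ[ℂ] SRA n ν →ₗ[ℂ] ℂ :=
  (LinearMap.mul ℂ (SRA n ν)).compr₂ sp

/-- The kernel `{x | B_sp(x, y) = 0 for all y}` of the form `B_sp`. -/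
def formKernel (sp : SRA n ν →ₗ[ℂ] ℂ) : Submodule ℂ (SRA n ν) := LinearMap.ker (form sp)

theorem mem_formKernel (sp : SRA n ν →ₗ[ℂ] ℂ) (x : SRA n ν) :
    x ∈ formKernel sp ↔ ∀ y, sp (x * y) = 0 := by
  simp [formKernel, form, LinearMap.ext_iff]

/-- `tr` is the trace `tr_z` with normalization `τ` on `H_{1,ν}(I₂(2m+1))`. -/
def IsTrZ (m : ℕ) (z : ℤ) (τ ν : ℂ) (tr : SRA (2 * m + 1) ν →ₗ[ℂ] ℂ) : Prop :=
  IsTrace tr ∧ ∀ k : ℕ, 1 ≤ k → k ≤ m →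
    tr (S (2 * m + 1) ν (k : ZMod (2 * m + 1))) =
      τ / ((2 * m + 1) * Complex.sin (Real.pi * k / (2 * m + 1)) ^ 2) *
        (1 - Complex.cos (2 * Real.pi * k * z / (2 * m + 1)))

/-- `str` is the supertrace `str_z` with normalization `τ` on `H_{1,ν}(I₂(2m+1))`. -/
def IsStrZ (m : ℕ) (z : ℤ) (τ ν : ℂ) (str : SRA (2 * m + 1) ν →ₗ[ℂ] ℂ) : Prop :=
  IsSupertrace str ∧ ∀ k : ℕ, k ≤ m →
    str (S (2 * m + 1) ν (k : ZMod (2 * m + 1))) =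
      τ / ((2 * m + 1) * Complex.cos (Real.pi * k / (2 * m + 1)) ^ 2) *
        (1 - (-1) ^ z * Complex.cos (2 * Real.pi * k * z / (2 * m + 1)))

end

end DihedralSRA

/-! Put `N = |z|`. The trace and the supertrace turn out to be, up to nonzero factors, the character
and the supercharacter of one and the same representation `ρ` of dimension `N²`, and these two have
the same kernel for a formal reason.

The representation. The algebra acts on functions of `(d, i) ∈ ℤ²`: the rotation `S_k` multiplies by
`λ^(-kd)`, `R_0` is the reflection `d ↦ -d` times a sign `σ`, `a^α` raises and `b^α` lowers the
residue of `d` modulo `n`, and `n ν = -σ N`. Unmixed shifts would produce the `μ L_p` terms only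
near `d = 0`. The relations demand them on a whole residue class, and the extra terms with
`mixCoeff` supply the rest; they have no pole because `n ∤ N`. Functions supported on the points
with `0 ≤ i < N - |d|` form an invariant subspace. On it `K = (-1)^d` is a parity operator, so `tr
ρ(x)` is a trace and `tr (K ρ(x))` a supertrace.

The values. The sum of `w^d` over these points is `(∑_{p<N} w^p)(∑_{q<N} w^(-q))`
(`sum_sites_zpow_mul`). At `w = λ^(-k)` and `w = -λ^(-k)` this gives the prescribed values on the
rotations, up to the factors `2τ/n` and `2τ'/n`.

Uniqueness. A trace is determined by its values on the nontrivial rotations and a supertrace by its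
values on all rotations (`IsTrace.eq_zero`, `IsSupertrace.eq_zero`). This goes by induction on word
length: cyclicity kills words followed by a rotation that fixes no generator up to the relevant
sign, and commutators with a suitable vector reduce the other group elements to those already
treated. Hence `tr_z` and `str_z` are multiples of the two characters.

Comparison. `K` lies in the image of `ρ`, being a polynomial in the diagonal operator `a^0 b^1 + a^1
b^0` (`exists_siteRep_eq_siteParity`). If `K = ρ(κ)`, then `str(xy) = tr(xyκ)` and, as `K² = 1`,
`tr(xy) = str(xyκ)`. So the two forms have equal kernels, and the kernel of a trace form is a
two-sided ideal. -/

namespace DihedralSRA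

/-! ### Operators on the lattice and the relations between them -/

noncomputable section

variable {n : ℕ}

/-- The ratio `N / (N - d)` at multiples `d` of `n`, and `0` elsewhere. -/
def mixCoeff (n : ℕ) (N d : ℤ) : ℂ := if (d : ZMod n) = 0 then (N : ℂ) / (N - d) else 0

/-- The operator by which `a^0` acts on functions on the lattice. -/
def latA0 (n : ℕ) (N : ℤ) : Module.End ℂ (ℤ → ℤ → ℂ) where
  toFun F d i := if 1 ≤ d then ((N : ℂ) - d - i) * F (d - 1) i - mixCoeff n N d * F (-d - 1) (i - 1)
    else -F (d - 1) (i - 1) + mixCoeff n N (1 - d) * F (1 - d) (i - 1)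
  map_add' F G := by
    ext d i
    simp only [Pi.add_apply]
    split_ifs <;> ring
  map_smul' c F := by
    ext d i
    simp only [Pi.smul_apply, smul_eq_mul, RingHom.id_apply]
    split_ifs <;> ring

/-- The operator by which `a^1` acts on functions on the lattice. -/
def latA1 (n : ℕ) (N : ℤ) : Module.End ℂ (ℤ → ℤ → ℂ) where
  toFun F d i := if 1 ≤ d then -((i : ℂ) + 1) * F (d - 1) (i + 1) - mixCoeff n N d * F (-d - 1) i
    else -F (d - 1) i + mixCoeff n N (1 - d) * F (1 - d) i
  map_add' F G := by
    ext d i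
    simp only [Pi.add_apply]
    split_ifs <;> ring
  map_smul' c F := by
    ext d i
    simp only [Pi.smul_apply, smul_eq_mul, RingHom.id_apply]
    split_ifs <;> ring

/-- The operator by which the reflection `R_0` acts. -/
def latR (σ : ℂ) : Module.End ℂ (ℤ → ℤ → ℂ) where
  toFun F d i := σ * F (-d) i
  map_add' F G := by
    ext d i
    simp only [Pi.add_apply]
    ring
  map_smul' c F := by
    ext d i
    simp only [Pi.smul_apply, smul_eq_mul, RingHom.id_apply]
    ring

/-- Pointwise multiplication by a function. -/
def latMul (f : ℤ → ℤ → ℂ) : Module.End ℂ (ℤ → ℤ → ℂ) where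
  toFun F d i := f d i * F d i
  map_add' F G := by
    ext d i
    simp only [Pi.add_apply]
    ring
  map_smul' c F := by
    ext d i
    simp only [Pi.smul_apply, smul_eq_mul, RingHom.id_apply]
    ring

/-- The projection to the functions supported on `d ≡ q` modulo `n`. -/
def latP (n : ℕ) (q : ZMod n) : Module.End ℂ (ℤ → ℤ → ℂ) :=
  latMul fun d _ => if (d : ZMod n) = q then 1 else 0

def latA (n : ℕ) (N : ℤ) (α : Fin 2) : Module.End ℂ (ℤ → ℤ → ℂ) := ![latA0 n N, latA1 n N] α

def latB (n : ℕ) (N : ℤ) (σ : ℂ) (α : Fin 2) : Module.End ℂ (ℤ → ℤ → ℂ) :=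
  (-1 : ℂ) • (latR σ * latA n N α * latR σ)

theorem latA0_apply (N : ℤ) (F : ℤ → ℤ → ℂ) (d i : ℤ) : latA0 n N F d i =
    if 1 ≤ d then ((N : ℂ) - d - i) * F (d - 1) i - mixCoeff n N d * F (-d - 1) (i - 1)
    else -F (d - 1) (i - 1) + mixCoeff n N (1 - d) * F (1 - d) (i - 1) := rfl

theorem latA1_apply (N : ℤ) (F : ℤ → ℤ → ℂ) (d i : ℤ) : latA1 n N F d i =
    if 1 ≤ d then -((i : ℂ) + 1) * F (d - 1) (i + 1) - mixCoeff n N d * F (-d - 1) i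
    else -F (d - 1) i + mixCoeff n N (1 - d) * F (1 - d) i := rfl

theorem latR_apply (σ : ℂ) (F : ℤ → ℤ → ℂ) (d i : ℤ) : latR σ F d i = σ * F (-d) i := rfl

theorem latMul_apply (f F : ℤ → ℤ → ℂ) (d i : ℤ) : latMul f F d i = f d i * F d i := rfl

theorem latR_mul_self {σ : ℂ} (hσ : σ * σ = 1) : latR σ * latR σ = 1 := by
  ext F d i
  simp only [Module.End.mul_apply, latR_apply, neg_neg, ← mul_assoc, hσ, one_mul,
    Module.End.one_apply]

theorem latR_mul_latP (σ : ℂ) (q : ZMod n) : latR σ * latP n q = latP n (-q) * latR σ := by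
  ext F d i
  simp only [Module.End.mul_apply, latR_apply, latP, latMul_apply, Int.cast_neg, neg_eq_iff_eq_neg]
  ring

/-- The mixing terms read `F` at `-d - 1` or `1 - d` instead of `d - 1`. Where the coefficient is
nonzero, `d ≡ 0` or `d ≡ 1` respectively, and there these points are congruent to `d - 1` modulo
`n`. -/
theorem latA_mul_latP (N : ℤ) (q : ZMod n) (α : Fin 2) :
    latA n N α * latP n q = latP n (q + 1) * latA n N α := by
  have key : ∀ d : ℤ, mixCoeff n N d ≠ 0 → (d : ZMod n) = 0 := by
    intro d h
    by_contra h'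
    exact h (by simp [mixCoeff, h'])
  have hsub : ∀ d : ℤ, ((d : ZMod n) - 1 = q) ↔ (d : ZMod n) = q + 1 := fun d => sub_eq_iff_eq_add
  have h1 : ∀ (d : ℤ) (x : ℂ), mixCoeff n N d * ((if -(d : ZMod n) - 1 = q then 1 else 0) * x) =
      (if (d : ZMod n) = q + 1 then 1 else 0) * (mixCoeff n N d * x) := by
    intro d x
    by_cases h : mixCoeff n N d = 0
    · simp [h]
    · rw [key d h, mul_left_comm]
      simp only [neg_zero, zero_sub, neg_eq_iff_eq_neg, eq_comm (a := (0 : ZMod n)),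
        eq_comm (a := (1 : ZMod n)), add_eq_zero_iff_eq_neg]
  have h2 : ∀ (d : ℤ) (x : ℂ), mixCoeff n N (1 - d) *
      ((if 1 - (d : ZMod n) = q then 1 else 0) * x) =
      (if (d : ZMod n) = q + 1 then 1 else 0) * (mixCoeff n N (1 - d) * x) := by
    intro d x
    by_cases h : mixCoeff n N (1 - d) = 0
    · simp [h]
    · have := key _ h
      push_cast at this
      have h3 : (d : ZMod n) = 1 := (sub_eq_zero.mp this).symm
      rw [h3, mul_left_comm]
      simp [eq_comm]
  have hcast : ∀ d : ℤ, ((-d - 1 : ℤ) : ZMod n) = -(d : ZMod n) - 1 := by intro d; push_cast; rfl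
  ext F d i
  fin_cases α
  · simp only [latA, latP, Module.End.mul_apply, latMul_apply, latA0_apply, Fin.zero_eta,
      Matrix.cons_val_zero, hcast, Int.cast_sub, Int.cast_one, hsub, h1, h2]
    split_ifs <;> ring
  · simp only [latA, latP, Module.End.mul_apply, latMul_apply, latA1_apply, Fin.mk_one,
      Matrix.cons_val_one, Matrix.cons_val_zero, hcast, Int.cast_sub, Int.cast_one, hsub, h1, h2]
    split_ifs <;> ring

/-- Since `n ∤ N`, the denominator `N - d` is nonzero at multiples of `n`. This identity is the
source of the `μ L_p` terms away from `d = 0`. -/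
theorem mixCoeff_mul {N : ℤ} (hN : (N : ZMod n) ≠ 0) (d : ℤ) :
    mixCoeff n N d * (N - d) = if (d : ZMod n) = 0 then (N : ℂ) else 0 := by
  unfold mixCoeff
  split_ifs with h
  · refine div_mul_cancel₀ _ fun h' => hN ?_
    have : N = d := by exact_mod_cast sub_eq_zero.mp h'
    rw [this, h]
  · simp

theorem mixCoeff_one (hn : 3 ≤ n) (N : ℤ) : mixCoeff n N 1 = 0 := by
  have : Fact (1 < n) := ⟨by omega⟩
  simp [mixCoeff]

/-- Consecutive integers are not both multiples of `n`. Hence products of two mixing terms drop out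
of the compositions below. -/
theorem mixCoeff_mul_succ (hn : 3 ≤ n) (N d : ℤ) :
    mixCoeff n N d * mixCoeff n N (1 + d) = 0 := by
  have : Fact (1 < n) := ⟨by omega⟩
  by_cases h : (d : ZMod n) = 0 <;> simp [mixCoeff, h]

theorem latA0_mul_latA1_sub {N : ℤ} (hn : 3 ≤ n) (hN : (N : ZMod n) ≠ 0) {σ : ℂ}
    (hσ : σ * σ = 1) :
    latA0 n N * latA1 n N - latA1 n N * latA0 n N = (-(σ * N)) • (latP n 1 * latR σ) := by
  ext F d i
  have : Fact (1 < n) := ⟨by omega⟩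
  have h1 : (0 : ZMod n) ≠ 1 := zero_ne_one
  have m1 := mixCoeff_one hn N
  have e1 : mixCoeff n N (-1 + d) * (N - (d - 1)) =
      N * if (d : ZMod n) = 1 then 1 else 0 := by
    rw [neg_add_eq_sub, ← Int.cast_one (R := ℂ), ← Int.cast_sub, mixCoeff_mul hN]
    simp [sub_eq_zero]
  have e2 : mixCoeff n N (1 - d) * (N - (1 - d)) =
      N * if (d : ZMod n) = 1 then 1 else 0 := by
    rw [← Int.cast_one (R := ℂ), ← Int.cast_sub, mixCoeff_mul hN]
    simp [sub_eq_zero, eq_comm (a := (1 : ZMod n))]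
  have hs : ∀ x y : ℂ, -(σ * N) * (x * (σ * y)) = - N * x * y := fun x y => by
    linear_combination (-N * x * y) * hσ
  simp only [LinearMap.sub_apply, Module.End.mul_apply, Pi.sub_apply, latA0_apply, latA1_apply,
    LinearMap.smul_apply, Pi.smul_apply, smul_eq_mul, latP, latMul_apply, latR_apply, hs]
  -- The operators are defined piecewise, and the cases fix the branch at each shifted argument. At
  -- `d = 1` the term `-N F(-1, i)` comes from the unmixed shifts alone; for `d ≥ 2` and `d ≤ -1` it
  -- comes from `mixCoeff`.
  have hd : 2 ≤ d ∨ d = 1 ∨ d = 0 ∨ d ≤ -1 := by omega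
  rcases hd with hd | rfl | rfl | hd
  · simp only [if_pos (show 1 ≤ d by omega), if_pos (show 1 ≤ d - 1 by omega),
      if_neg (show ¬ 1 ≤ -d - 1 by omega)]
    push_cast
    ring_nf
    linear_combination (-F (-d) i) * e1
  · simp
    ring_nf
    simp [m1]
  · simp [h1]
    ring_nf
    simp [m1]
  · simp only [if_neg (show ¬ 1 ≤ d by omega), if_neg (show ¬ 1 ≤ d - 1 by omega),
      if_pos (show 1 ≤ 1 - d by omega)]
    push_cast
    ring_nf
    linear_combination (-F (-d) i) * e2

theorem latB_zero_apply {σ : ℂ} (hσ : σ * σ = 1) (N : ℤ) (F : ℤ → ℤ → ℂ) (d i : ℤ) :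
    latB n N σ 0 F d i =
      if d ≤ -1 then -(((N : ℂ) + d - i) * F (d + 1) i - mixCoeff n N (-d) * F (1 - d) (i - 1))
      else F (d + 1) (i - 1) - mixCoeff n N (1 + d) * F (-1 - d) (i - 1) := by
  simp only [latB, latA, Matrix.cons_val_zero, LinearMap.smul_apply, Pi.smul_apply, smul_eq_mul,
    Module.End.mul_apply, latR_apply, latA0_apply, show (1 ≤ -d) = (d ≤ -1) by grind]
  split_ifs <;> push_cast <;> ring_nf <;> simp only [pow_two, hσ] <;> ring_nf

theorem latB_one_apply {σ : ℂ} (hσ : σ * σ = 1) (N : ℤ) (F : ℤ → ℤ → ℂ) (d i : ℤ) :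
    latB n N σ 1 F d i =
      if d ≤ -1 then ((i : ℂ) + 1) * F (d + 1) (i + 1) + mixCoeff n N (-d) * F (1 - d) i
      else F (d + 1) i - mixCoeff n N (1 + d) * F (-1 - d) i := by
  simp only [latB, latA, Matrix.cons_val_one, Matrix.cons_val_zero, LinearMap.smul_apply,
    Pi.smul_apply, smul_eq_mul, Module.End.mul_apply, latR_apply, latA1_apply,
    show (1 ≤ -d) = (d ≤ -1) by grind]
  split_ifs <;> ring_nf <;> simp only [pow_two, hσ] <;> ring_nf

theorem latB_mul_latP {N : ℤ} {σ : ℂ} (q : ZMod n) (α : Fin 2) :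
    latB n N σ α * latP n q = latP n (q - 1) * latB n N σ α := by
  rw [latB, smul_mul_assoc, mul_assoc, latR_mul_latP, ← mul_assoc, mul_assoc (latR σ),
    latA_mul_latP, ← mul_assoc, latR_mul_latP, mul_smul_comm, neg_add, neg_neg, ← sub_eq_add_neg]
  simp only [mul_assoc]

theorem latA_mul_latB_sub {N : ℤ} (hn : 3 ≤ n) (hN : (N : ZMod n) ≠ 0) {σ : ℂ}
    (hσ : σ * σ = 1) (α β : Fin 2) :
    latA n N α * latB n N σ β - latB n N σ β * latA n N α =
      eps α β • (1 + (-(σ * N)) • (latP n 0 * latR σ)) := by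
  ext F d i
  have : Fact (1 < n) := ⟨by omega⟩
  have h1 : (1 : ZMod n) ≠ 0 := one_ne_zero
  have m1 := mixCoeff_one hn N
  have e1 : mixCoeff n N d * (N - d) = N * if (d : ZMod n) = 0 then 1 else 0 := by
    rw [mixCoeff_mul hN]
    simp
  have e2 : mixCoeff n N (-d) * (N + d) = N * if (d : ZMod n) = 0 then 1 else 0 := by
    have := mixCoeff_mul hN (-d)
    rw [Int.cast_neg, Int.cast_neg, sub_neg_eq_add] at this
    rw [this]
    simp
  have hs : ∀ x y : ℂ, -(σ * N) * (x * (σ * y)) = - N * x * y := fun x y => by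
    linear_combination (-N * x * y) * hσ
  have m23 := mixCoeff_mul_succ hn N 2
  have p0 := mixCoeff_mul_succ hn N d
  have p1 := mixCoeff_mul_succ hn N (1 + d)
  have p2 := mixCoeff_mul_succ hn N (-d)
  have p3 := mixCoeff_mul_succ hn N (1 - d)
  norm_num at m23
  ring_nf at p1 p2 p3
  have hd : 2 ≤ d ∨ d = 1 ∨ d = 0 ∨ d = -1 ∨ d ≤ -2 := by omega
  fin_cases α <;> fin_cases β <;>
  simp only [LinearMap.sub_apply, LinearMap.add_apply, Module.End.one_apply, Pi.add_apply,
    Module.End.mul_apply, Pi.sub_apply, latA, latA0_apply, latA1_apply, latB_zero_apply hσ,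
    latB_one_apply hσ, LinearMap.smul_apply, Pi.smul_apply, smul_eq_mul, latP, latMul_apply,
    latR_apply, hs, eps, Fin.zero_eta, Fin.mk_one, Matrix.cons_val_zero, Matrix.cons_val_one,
    Matrix.of_apply, Matrix.cons_val', Matrix.cons_val_fin_one, zero_mul] <;>
  rcases hd with hd | rfl | rfl | rfl | hd
  all_goals simp (disch := omega) only [if_pos, if_neg]
  all_goals push_cast
  all_goals ring_nf
  all_goals try simp only [m1, h1, neg_eq_zero, if_true, if_false]
  all_goals grind

/-- This is the weight operator of the `sl₂` acting on the index `α`: for fixed `d` the coordinate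
`i` counts steps down from the highest weight `N - 1 - |d|`. Its eigenvalue determines the parity of
`d`, which later places the parity operator in the image of the algebra. -/
theorem latA_mul_latB_add {N : ℤ} (hn : 3 ≤ n) {σ : ℂ} (hσ : σ * σ = 1) :
    latA n N 0 * latB n N σ 1 + latA n N 1 * latB n N σ 0 =
      latMul fun d i => N - 1 - (|d| : ℤ) - 2 * i := by
  ext F d i
  have m1 := mixCoeff_one hn N
  have p0 := mixCoeff_mul_succ hn N d
  have p1 := mixCoeff_mul_succ hn N (1 + d)
  have p2 := mixCoeff_mul_succ hn N (-d)
  have p3 := mixCoeff_mul_succ hn N (1 - d)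
  ring_nf at p1 p2 p3
  have hd : 1 ≤ d ∨ d = 0 ∨ d ≤ -1 := by omega
  simp only [LinearMap.add_apply, Pi.add_apply, Module.End.mul_apply, latA, latA0_apply,
    latA1_apply, latB_zero_apply hσ, latB_one_apply hσ, latMul_apply, Matrix.cons_val_zero,
    Matrix.cons_val_one, Matrix.cons_val_fin_one]
  rcases hd with hd | rfl | hd
  · rw [abs_of_nonneg (by omega)]
    simp (disch := omega) only [if_pos, if_neg]
    push_cast
    ring_nf
    grind
  · rw [abs_zero]
    simp (disch := omega) only [if_pos, if_neg]
    push_cast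
    ring_nf
    grind
  · rw [abs_of_nonpos (by omega)]
    simp (disch := omega) only [if_pos, if_neg]
    push_cast
    ring_nf
    grind

theorem latA_mul_latA_sub {N : ℤ} (hn : 3 ≤ n) (hN : (N : ZMod n) ≠ 0) {σ : ℂ}
    (hσ : σ * σ = 1) (α β : Fin 2) :
    latA n N α * latA n N β - latA n N β * latA n N α =
      eps α β • ((-(σ * N)) • (latP n 1 * latR σ)) := by
  fin_cases α <;> fin_cases β <;> simp only [latA, eps, Fin.zero_eta, Fin.mk_one,
    Matrix.cons_val_zero, Matrix.cons_val_one, Matrix.of_apply, Matrix.cons_val',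
    Matrix.cons_val_fin_one, zero_smul, sub_self, one_smul]
  · exact latA0_mul_latA1_sub hn hN hσ
  · rw [← latA0_mul_latA1_sub hn hN hσ]
    exact (neg_sub _ _).symm.trans (neg_one_smul ℂ _).symm

theorem latB_mul_latB (N : ℤ) {σ : ℂ} (hσ : σ * σ = 1) (α β : Fin 2) :
    latB n N σ α * latB n N σ β = latR σ * (latA n N α * latA n N β) * latR σ := by
  have h := latR_mul_self hσ
  calc _ = latR σ * latA n N α * (latR σ * latR σ) * latA n N β * latR σ := by
        simp only [latB, smul_mul_smul_comm, mul_neg, mul_one, neg_neg, one_smul, mul_assoc]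
    _ = _ := by rw [h, mul_one]; simp only [mul_assoc]

/-- Conjugation by `R_0` exchanges `a^α` and `-b^α` and turns the projection to the residue `1` into
that to `-1`, so this follows from the commutators of the `a^α`. -/
theorem latB_mul_latB_sub {N : ℤ} (hn : 3 ≤ n) (hN : (N : ZMod n) ≠ 0) {σ : ℂ}
    (hσ : σ * σ = 1) (α β : Fin 2) :
    latB n N σ α * latB n N σ β - latB n N σ β * latB n N σ α =
      eps α β • ((-(σ * N)) • (latP n (-1) * latR σ)) := by
  rw [latB_mul_latB N hσ, latB_mul_latB N hσ, ← sub_mul, ← mul_sub, latA_mul_latA_sub hn hN hσ]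
  simp only [mul_smul_comm, smul_mul_assoc]
  rw [← mul_assoc, latR_mul_latP, mul_assoc (latP n _), latR_mul_self hσ, mul_one]

/-- The operator by which the rotation `S_k` acts. -/
def latS (n : ℕ) [NeZero n] (k : ZMod n) : Module.End ℂ (ℤ → ℤ → ℂ) :=
  latMul fun d _ => ZMod.stdAddChar (-(k * (d : ZMod n)))

theorem latMul_mul (f g : ℤ → ℤ → ℂ) : latMul f * latMul g = latMul (f * g) := by
  ext F d i
  simp only [Module.End.mul_apply, latMul_apply, Pi.mul_apply, mul_assoc]

theorem sum_smul_latS [NeZero n] (p : ZMod n) :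
    ((1 / (n : ℂ)) • ∑ k : ZMod n, (ZMod.stdAddChar (k * p) : ℂ) • latS n k) = latP n p := by
  ext F d i
  have hn0 : (n : ℂ) ≠ 0 := Nat.cast_ne_zero.mpr (NeZero.ne n)
  have h := AddChar.sum_mulShift (p - (d : ZMod n)) (ZMod.isPrimitive_stdAddChar n)
  simp only [LinearMap.smul_apply, LinearMap.sum_apply, Pi.smul_apply, Finset.sum_apply,
    smul_eq_mul, latS, latP, latMul_apply, ← mul_assoc, ← AddChar.map_add_eq_mul, ← Finset.sum_mul,
    ← sub_eq_add_neg, ← mul_sub, h, sub_eq_zero, ZMod.card, eq_comm (a := p)]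
  split_ifs <;> simp [hn0]

theorem latS_mul_latR [NeZero n] (σ : ℂ) (k : ZMod n) : latR σ * latS n k = latS n (-k) * latR σ := by
  ext F d i
  simp only [Module.End.mul_apply, latS, latMul_apply, latR_apply, Int.cast_neg, mul_neg, neg_neg,
    neg_mul]
  ring

/-! ### The lattice representation -/

/-- The action of the generators on functions on the lattice. -/
def latGen (n : ℕ) [NeZero n] (N : ℤ) (σ : ℂ) : Gen n → Module.End ℂ (ℤ → ℤ → ℂ)
  | Gen.a α => latA n N α
  | Gen.b α => latB n N σ α
  | Gen.grp (DihedralGroup.r k) => latS n k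
  | Gen.grp (DihedralGroup.sr k) => latS n (-k) * latR σ

/-- The action of the free algebra on functions on the lattice. -/
def latRep (n : ℕ) [NeZero n] (N : ℤ) (σ : ℂ) : Free n →ₐ[ℂ] Module.End ℂ (ℤ → ℤ → ℂ) :=
  FreeAlgebra.lift ℂ (latGen n N σ)

variable [NeZero n]

theorem latRep_fa (N : ℤ) (σ : ℂ) (α : Fin 2) : latRep n N σ (fa n α) = latA n N α := by
  simp [latRep, fa, latGen]

theorem latRep_fb (N : ℤ) (σ : ℂ) (α : Fin 2) : latRep n N σ (fb n α) = latB n N σ α := by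
  simp [latRep, fb, latGen]

theorem latRep_rot (N : ℤ) (σ : ℂ) (k : ZMod n) : latRep n N σ (fg (rot n k)) = latS n k := by
  simp [latRep, fg, latGen, rot]

theorem latRep_reflec (N : ℤ) (σ : ℂ) (k : ZMod n) :
    latRep n N σ (fg (reflec n k)) = latS n k * latR σ := by
  simp [latRep, fg, latGen, reflec]

theorem latRep_fL (N : ℤ) (σ : ℂ) (p : ZMod n) :
    latRep n N σ (fL n p) = latP n p * latR σ := by
  rw [fL, map_smul, map_sum]
  simp only [map_smul, latRep_reflec]
  rw [← sum_smul_latS, smul_mul_assoc, Finset.sum_mul]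
  simp only [smul_mul_assoc]

theorem latRep_fQ (N : ℤ) (σ : ℂ) (p : ZMod n) : latRep n N σ (fQ n p) = latP n (-p) := by
  rw [fQ, map_smul, map_sum]
  simp only [map_smul, latRep_rot]
  rw [← sum_smul_latS]
  simp only [mul_neg]

theorem latS_mul_latS (k l : ZMod n) : latS n k * latS n l = latS n (k + l) := by
  rw [latS, latS, latS, latMul_mul]
  congr 1
  ext d i
  simp only [Pi.mul_apply, ← AddChar.map_add_eq_mul]
  congr 1
  ring

/-- The action of the free algebra respects the defining relations. -/
theorem latRep_rel {N : ℤ} (hn : 3 ≤ n) (hN : (N : ZMod n) ≠ 0) {σ : ℂ} (hσ : σ * σ = 1) {ν : ℂ}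
    (hν : n * ν = -(σ * N)) {x y : Free n} (h : Rel n ν x y) :
    latRep n N σ x = latRep n N σ y := by
  have hR := latR_mul_self hσ
  have hneg : ∀ T : Module.End ℂ (ℤ → ℤ → ℂ), -T = (-1 : ℂ) • T :=
    fun T => (neg_one_smul ℂ T).symm
  cases h with
  | grp_one =>
    rw [map_one, DihedralGroup.one_def]
    refine (latRep_rot N σ 0).trans ?_
    ext F d i
    simp [latS, latMul_apply]
  | grp_mul g h =>
    rw [map_mul]
    rcases g with k | k <;> rcases h with l | l <;>
      simp only [latRep, fg, FreeAlgebra.lift_ι_apply, latGen, DihedralGroup.r_mul_r,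
        DihedralGroup.r_mul_sr, DihedralGroup.sr_mul_r, DihedralGroup.sr_mul_sr, ← mul_assoc,
        latS_mul_latS]
    · congr 2; ring
    · rw [mul_assoc, latS_mul_latR, ← mul_assoc, latS_mul_latS]
      congr 2; ring
    · rw [mul_assoc (latS n (-k)), latS_mul_latR, ← mul_assoc, latS_mul_latS, mul_assoc, hR, mul_one]
      congr 1; ring
  | L_a p α =>
    simp only [map_mul, map_neg, latRep_fL, latRep_fa, latRep_fb]
    rw [← mul_assoc, latB_mul_latP, add_sub_cancel_right, latB, mul_smul_comm, smul_mul_assoc]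
    refine Eq.trans ?_ (hneg _).symm
    rw [smul_smul, neg_one_mul, neg_neg, one_smul]
    simp only [mul_assoc, hR, mul_one]
  | L_b p α =>
    simp only [map_mul, map_neg, latRep_fL, latRep_fa, latRep_fb]
    rw [← mul_assoc, latA_mul_latP, sub_add_cancel, latB, mul_smul_comm]
    refine Eq.trans ?_ (hneg _).symm
    simp only [← mul_assoc]
    rw [mul_assoc (latP n p), hR, mul_one]
  | Q_a p α =>
    simp only [map_mul, latRep_fQ, latRep_fa]
    rw [latA_mul_latP]
    congr 2; ring
  | Q_b p α =>
    simp only [map_mul, latRep_fQ, latRep_fb]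
    rw [latB_mul_latP]
    congr 2; ring
  | comm_ab α β =>
    simp only [map_mul, map_sub, map_smul, map_add, map_one, latRep_fL, latRep_fa, latRep_fb, hν]
    exact latA_mul_latB_sub hn hN hσ α β
  | comm_aa α β =>
    simp only [map_mul, map_sub, map_smul, latRep_fL, latRep_fa, hν]
    exact latA_mul_latA_sub hn hN hσ α β
  | comm_bb α β =>
    simp only [map_mul, map_sub, map_smul, latRep_fL, latRep_fb, hν]
    exact latB_mul_latB_sub hn hN hσ α β

end

end DihedralSRA

/-! ### The finite-dimensional invariant subspace -/

namespace DihedralSRA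

noncomputable section

variable {n : ℕ} [NeZero n]

/-- The lattice points `(d, i)` with `0 ≤ i` and `i + |d| < N`. -/
def sites (N : ℕ) : Finset (ℤ × ℤ) :=
  (Finset.Ioo (-(N : ℤ)) N ×ˢ Finset.Ico (0 : ℤ) N).filter fun p =>
    p.2 + p.1 < N ∧ p.2 - p.1 < N

theorem mem_sites {N : ℕ} {d i : ℤ} : (d, i) ∈ sites N ↔ 0 ≤ i ∧ i + d < N ∧ i - d < N := by
  simp only [sites, Finset.mem_filter, Finset.mem_product, Finset.mem_Ioo, Finset.mem_Ico]
  omega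

/-- Extension by zero of a function on the sites. -/
def siteExt (N : ℕ) : (sites N → ℂ) →ₗ[ℂ] (ℤ → ℤ → ℂ) where
  toFun f d i := if h : (d, i) ∈ sites N then f ⟨(d, i), h⟩ else 0
  map_add' f g := by
    ext d i
    simp only [Pi.add_apply]
    split_ifs <;> simp
  map_smul' c f := by
    ext d i
    simp only [Pi.smul_apply, smul_eq_mul, RingHom.id_apply]
    split_ifs <;> simp

/-- Restriction of a function to the sites. -/
def siteRes (N : ℕ) : (ℤ → ℤ → ℂ) →ₗ[ℂ] (sites N → ℂ) where
  toFun F p := F p.1.1 p.1.2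
  map_add' _ _ := rfl
  map_smul' _ _ := rfl

theorem siteRes_siteExt (N : ℕ) (f : sites N → ℂ) : siteRes N (siteExt N f) = f := by
  ext p
  simp [siteRes, siteExt]

theorem siteExt_injective (N : ℕ) : Function.Injective (siteExt N) :=
  Function.LeftInverse.injective (siteRes_siteExt N)

/-- The function `F` vanishes off the sites. -/
def IsSiteSupported (N : ℕ) (F : ℤ → ℤ → ℂ) : Prop := ∀ d i, (d, i) ∉ sites N → F d i = 0

theorem isSiteSupported_siteExt (N : ℕ) (f : sites N → ℂ) : IsSiteSupported N (siteExt N f) := by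
  intro d i h
  simp [siteExt, h]

theorem siteExt_siteRes {N : ℕ} {F : ℤ → ℤ → ℂ} (hF : IsSiteSupported N F) :
    siteExt N (siteRes N F) = F := by
  ext d i
  by_cases h : (d, i) ∈ sites N
  · simp [siteExt, siteRes, h]
  · simp [siteExt, h, hF d i h]

theorem IsSiteSupported.latMul {N : ℕ} {F : ℤ → ℤ → ℂ} (hF : IsSiteSupported N F)
    (f : ℤ → ℤ → ℂ) : IsSiteSupported N (latMul f F) := by
  intro d i h
  rw [latMul_apply, hF d i h, mul_zero]

theorem IsSiteSupported.latR {N : ℕ} {F : ℤ → ℤ → ℂ} (hF : IsSiteSupported N F)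
    (σ : ℂ) : IsSiteSupported N (latR σ F) := by
  intro d i h
  rw [latR_apply, hF, mul_zero]
  rw [mem_sites] at h ⊢
  omega

-- A value off the sites could only arise by stepping across the boundary, and there the coefficient
-- vanishes: `N - d - i` at `i = N - d` for `a^0`, and `i + 1` at `i = -1` for `a^1`. All other
-- terms read `F` off the sites.
omit [NeZero n] in
theorem IsSiteSupported.latA {N : ℕ} {F : ℤ → ℤ → ℂ} (hF : IsSiteSupported N F)
    (α : Fin 2) : IsSiteSupported N (latA n N α F) := by
  intro d i h
  have h0 : ∀ d i : ℤ, ¬(0 ≤ i ∧ i + d < N ∧ i - d < N) → F d i = 0 :=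
    fun d i h => hF d i (by rwa [mem_sites])
  rw [mem_sites] at h
  fin_cases α
  · simp only [DihedralSRA.latA, Fin.zero_eta, Matrix.cons_val_zero, latA0_apply]
    split_ifs with hd
    · rw [h0 (-d - 1) (i - 1) (by omega), mul_zero, sub_zero]
      by_cases hi : i = N - d
      · rw [hi]
        push_cast
        ring
      · rw [h0 _ _ (by omega), mul_zero]
    · rw [h0 (d - 1) (i - 1) (by omega), h0 (1 - d) (i - 1) (by omega)]
      simp
  · simp only [DihedralSRA.latA, Fin.mk_one, Matrix.cons_val_one, Matrix.cons_val_zero,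
      latA1_apply]
    split_ifs with hd
    · rw [h0 (-d - 1) i (by omega), mul_zero, sub_zero]
      by_cases hi : i = -1
      · rw [hi]
        push_cast
        ring
      · rw [h0 _ _ (by omega), mul_zero]
    · rw [h0 (d - 1) i (by omega), h0 (1 - d) i (by omega)]
      simp

theorem IsSiteSupported.latGen {N : ℕ} {F : ℤ → ℤ → ℂ} (hF : IsSiteSupported N F) (σ : ℂ)
    (x : Gen n) : IsSiteSupported N (latGen n N σ x F) := by
  rcases x with α | α | (k | k)
  · exact hF.latA α
  · intro d i h
    exact (congrArg ((-1 : ℂ) * ·) (((hF.latR σ).latA α).latR σ d i h)).trans (mul_zero _)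
  · exact hF.latMul _
  · exact (hF.latR σ).latMul _

/-- The action of the generators on functions on the sites. -/
def siteGen (n : ℕ) [NeZero n] (N : ℕ) (σ : ℂ) (x : Gen n) : Module.End ℂ (sites N → ℂ) :=
  siteRes N ∘ₗ latGen n N σ x ∘ₗ siteExt N

/-- By invariance, extension by zero intertwines the two actions. The relations therefore need
checking only on the whole lattice, where the region has no boundary. -/
theorem siteExt_siteGen (N : ℕ) (σ : ℂ) (x : Gen n) (f : sites N → ℂ) :
    siteExt N (siteGen n N σ x f) = latGen n N σ x (siteExt N f) :=
  siteExt_siteRes ((isSiteSupported_siteExt N f).latGen σ x)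

theorem siteExt_lift_siteGen (N : ℕ) (σ : ℂ) (x : Free n) (f : sites N → ℂ) :
    siteExt N (FreeAlgebra.lift ℂ (siteGen n N σ) x f) = latRep n N σ x (siteExt N f) := by
  induction x using FreeAlgebra.induction generalizing f with
  | grade0 r => simp only [AlgHom.commutes, Module.algebraMap_end_apply, map_smul]
  | grade1 x => simp only [latRep, FreeAlgebra.lift_ι_apply, siteExt_siteGen]
  | mul a b ha hb => simp only [map_mul, Module.End.mul_apply, ha, hb]
  | add a b ha hb => simp only [map_add, LinearMap.add_apply, ha, hb]

/-- The finite-dimensional representation of the algebra on functions on the sites. -/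
def siteRep {N : ℕ} (hn : 3 ≤ n) (hN : (N : ZMod n) ≠ 0) {σ : ℂ} (hσ : σ * σ = 1) {ν : ℂ}
    (hν : n * ν = -(σ * N)) : SRA n ν →ₐ[ℂ] Module.End ℂ (sites N → ℂ) :=
  RingQuot.liftAlgHom ℂ ⟨FreeAlgebra.lift ℂ (siteGen n N σ), fun x y h => by
    refine LinearMap.ext fun f => siteExt_injective N ?_
    rw [siteExt_lift_siteGen, siteExt_lift_siteGen,
      latRep_rel hn (by exact_mod_cast hN) hσ (by exact_mod_cast hν) h]⟩

section

variable {N : ℕ} {hn : 3 ≤ n} {hN : (N : ZMod n) ≠ 0} {σ : ℂ} {hσ : σ * σ = 1} {ν : ℂ}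
  {hν : n * ν = -(σ * N)}

theorem siteExt_siteRep_mk (x : Free n) (f : sites N → ℂ) :
    siteExt N (siteRep hn hN hσ hν (RingQuot.mkAlgHom ℂ (Rel n ν) x) f) =
      latRep n N σ x (siteExt N f) := by
  rw [siteRep, RingQuot.liftAlgHom_mkAlgHom_apply, siteExt_lift_siteGen]

/-- If an element of the free algebra acts on the lattice by a multiplication, then it acts so on
the sites. -/
theorem siteRep_mk_eq_lmul {x : Free n} {f : ℤ → ℤ → ℂ} (h : latRep n N σ x = latMul f) :
    siteRep hn hN hσ hν (RingQuot.mkAlgHom ℂ (Rel n ν) x) =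
      Algebra.lmul ℂ (sites N → ℂ) fun p => f p.1.1 p.1.2 := by
  refine LinearMap.ext fun g => siteExt_injective N ?_
  rw [siteExt_siteRep_mk, h]
  ext d i
  by_cases hp : (d, i) ∈ sites N <;> simp [latMul_apply, siteExt, hp]

theorem siteRep_S (k : ZMod n) : siteRep hn hN hσ hν (S n ν k) =
    Algebra.lmul ℂ (sites N → ℂ) fun p => (ZMod.stdAddChar (-(k * (p.1.1 : ZMod n))) : ℂ) :=
  siteRep_mk_eq_lmul (latRep_rot N σ k)

/-! ### Parity, character and supercharacter -/

/-- The parity operator on functions on the sites. -/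
def siteParity (N : ℕ) : Module.End ℂ (sites N → ℂ) :=
  Algebra.lmul ℂ (sites N → ℂ) fun p => (-1) ^ p.1.1

theorem siteParity_mul_self (N : ℕ) : siteParity N * siteParity N = 1 := by
  rw [siteParity, ← map_mul, ← map_one (Algebra.lmul ℂ (sites N → ℂ))]
  congr 1
  ext p
  simp [← mul_zpow]

theorem siteExt_siteParity (N : ℕ) (f : sites N → ℂ) :
    siteExt N (siteParity N f) = latMul (fun d _ => (-1) ^ d) (siteExt N f) := by
  ext d i
  by_cases hp : (d, i) ∈ sites N <;> simp [latMul_apply, siteExt, hp, siteParity]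

/-- The points `d - 1`, `-d - 1` and `1 - d` read by `a^α` all have parity opposite to `d`, whereas
rotations and `d ↦ -d` preserve it. The parity is that of the integer `d`, which is not determined
by its residue modulo the odd number `n`. -/
theorem latMul_neg_one_zpow_mul_latGen (N : ℤ) (σ : ℂ) (x : Gen n) :
    latMul (fun d _ => (-1) ^ d) * latGen n N σ x =
      (-1 : ℂ) ^ x.parity.val • (latGen n N σ x * latMul (fun d _ => (-1) ^ d)) := by
  have h0 : (-1 : ℂ) ≠ 0 := by norm_num
  have h1 : ∀ d : ℤ, (-1 : ℂ) ^ (d - 1) = -(-1) ^ d := fun d => by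
    rw [zpow_sub_one₀ h0]; norm_num
  have h2 : ∀ d : ℤ, (-1 : ℂ) ^ (-d) = (-1) ^ d := fun d => by
    rw [zpow_neg, ← inv_zpow]; norm_num
  have h3 : ∀ d : ℤ, (-1 : ℂ) ^ (1 - d) = -(-1) ^ d := fun d => by
    rw [← h2, neg_sub, h1]
  have hA : ∀ α : Fin 2, latMul (fun d _ => (-1) ^ d) * latA n N α =
      (-1 : ℂ) • (latA n N α * latMul (fun d _ => (-1) ^ d)) := by
    intro α
    ext F d i
    fin_cases α
    · simp only [latA, Fin.zero_eta, Matrix.cons_val_zero, Module.End.mul_apply, latMul_apply,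
        latA0_apply, LinearMap.smul_apply, Pi.smul_apply, smul_eq_mul, h1, h2, h3]
      split_ifs <;> ring
    · simp only [latA, Fin.mk_one, Matrix.cons_val_one, Matrix.cons_val_zero, Module.End.mul_apply,
        latMul_apply, latA1_apply, LinearMap.smul_apply, Pi.smul_apply, smul_eq_mul, h1, h2, h3]
      split_ifs <;> ring
  have hR : latMul (fun d _ => (-1) ^ d) * latR σ = latR σ * latMul (fun d _ => (-1) ^ d) := by
    ext F d i
    simp only [Module.End.mul_apply, latMul_apply, latR_apply, h2]
    ring
  have hM : ∀ f : ℤ → ℤ → ℂ, latMul (fun d _ => (-1) ^ d) * latMul f =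
      latMul f * latMul (fun d _ => (-1) ^ d) := fun f => by
    rw [latMul_mul, latMul_mul, mul_comm]
  rcases x with α | α | (k | k)
  · simpa [latGen, Gen.parity, ZMod.val_one] using hA α
  · simp only [latGen, Gen.parity, ZMod.val_one, pow_one, latB]
    rw [mul_smul_comm, smul_mul_assoc, ← mul_assoc, ← mul_assoc, hR, mul_assoc (latR σ), hA,
      mul_assoc _ (latR σ) (latMul _), ← hR]
    simp only [mul_smul_comm, smul_mul_assoc, mul_assoc]
  · simpa [latGen, Gen.parity, latS] using hM _
  · simp only [latGen, Gen.parity, ZMod.val_zero, pow_zero, one_smul]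
    rw [← mul_assoc, latS, hM, mul_assoc, hR, mul_assoc]

theorem siteParity_mul_siteRep_gen (x : Gen n) :
    siteParity N * siteRep hn hN hσ hν (gen n ν x) =
      (-1 : ℂ) ^ x.parity.val • (siteRep hn hN hσ hν (gen n ν x) * siteParity N) := by
  refine LinearMap.ext fun f => siteExt_injective N ?_
  simp only [Module.End.mul_apply, siteExt_siteParity, gen, siteExt_siteRep_mk, LinearMap.smul_apply,
    map_smul, latRep, FreeAlgebra.lift_ι_apply]
  exact LinearMap.congr_fun (latMul_neg_one_zpow_mul_latGen (N : ℤ) σ x) (siteExt N f)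

theorem neg_one_pow_val_add (i j : ZMod 2) :
    (-1 : ℂ) ^ (i + j).val = (-1) ^ i.val * (-1) ^ j.val := by
  rw [← pow_add, ZMod.val_add, ← neg_one_pow_eq_pow_mod_two]

theorem siteParity_mul_siteRep {i : ZMod 2} {x : SRA n ν} (hx : x ∈ parityPart n ν i) :
    siteParity N * siteRep hn hN hσ hν x =
      (-1 : ℂ) ^ i.val • (siteRep hn hN hσ hν x * siteParity N) := by
  induction hx using Submodule.span_induction with
  | mem x hx =>
    obtain ⟨w, rfl, rfl⟩ := hx
    induction w with
    | nil => simp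
    | cons y w ih =>
      simp only [List.map_cons, List.prod_cons, List.sum_cons, map_mul, neg_one_pow_val_add]
      rw [← mul_assoc, siteParity_mul_siteRep_gen, smul_mul_assoc, mul_assoc, ih, mul_smul_comm,
        smul_smul, mul_assoc]
  | zero => simp
  | add x y _ _ hx hy => rw [map_add, mul_add, add_mul, hx, hy, smul_add]
  | smul c x _ hx => rw [map_smul, mul_smul_comm, smul_mul_assoc, hx, smul_comm]

/-- The character of the representation on functions on the sites. -/
def siteTrace (hn : 3 ≤ n) (hN : (N : ZMod n) ≠ 0) (hσ : σ * σ = 1)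
    (hν : n * ν = -(σ * N)) : SRA n ν →ₗ[ℂ] ℂ :=
  LinearMap.trace ℂ (sites N → ℂ) ∘ₗ (siteRep hn hN hσ hν).toLinearMap

/-- The supercharacter of the representation on functions on the sites. -/
def siteSupertrace (hn : 3 ≤ n) (hN : (N : ZMod n) ≠ 0) (hσ : σ * σ = 1)
    (hν : n * ν = -(σ * N)) : SRA n ν →ₗ[ℂ] ℂ :=
  LinearMap.trace ℂ (sites N → ℂ) ∘ₗ LinearMap.mulLeft ℂ (siteParity N) ∘ₗ
    (siteRep hn hN hσ hν).toLinearMap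

theorem siteTrace_apply (x : SRA n ν) : siteTrace hn hN hσ hν x =
    LinearMap.trace ℂ (sites N → ℂ) (siteRep hn hN hσ hν x) := rfl

theorem siteSupertrace_apply (x : SRA n ν) : siteSupertrace hn hN hσ hν x =
    LinearMap.trace ℂ (sites N → ℂ) (siteParity N * siteRep hn hN hσ hν x) := rfl

theorem isTrace_siteTrace : IsTrace (siteTrace hn hN hσ hν) := by
  intro f g
  rw [map_sub, siteTrace_apply, siteTrace_apply, map_mul (siteRep hn hN hσ hν),
    map_mul (siteRep hn hN hσ hν), LinearMap.trace_mul_comm,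
    sub_self]

/-- The parity operator `K` anticommutes with `ρ(x)`, so `tr (K ρ(x)) = -tr (ρ(x) K) = -tr (K
ρ(x))`. -/
theorem siteSupertrace_eq_zero {x : SRA n ν} (hx : x ∈ parityPart n ν 1) :
    siteSupertrace hn hN hσ hν x = 0 := by
  have h := siteParity_mul_siteRep (hn := hn) (hN := hN) (hσ := hσ) (hν := hν) hx
  rw [ZMod.val_one, pow_one] at h
  have h2 := congrArg (LinearMap.trace ℂ (sites N → ℂ)) h
  rw [map_smul, LinearMap.trace_mul_comm ℂ (siteRep hn hN hσ hν x), smul_eq_mul] at h2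
  rw [siteSupertrace_apply]
  linear_combination (1 / 2 : ℂ) * h2

theorem mul_mem_parityPart {i j : ZMod 2} {x y : SRA n ν} (hx : x ∈ parityPart n ν i)
    (hy : y ∈ parityPart n ν j) : x * y ∈ parityPart n ν (i + j) := by
  have h : parityPart n ν i * parityPart n ν j ≤ parityPart n ν (i + j) := by
    rw [parityPart, parityPart, Submodule.span_mul_span, Submodule.span_le]
    rintro _ ⟨_, ⟨w, rfl, rfl⟩, _, ⟨w', rfl, rfl⟩, rfl⟩
    exact Submodule.subset_span ⟨w ++ w', by simp, by simp⟩
  exact h (Submodule.mul_mem_mul hx hy)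

/-- Moving the parity operator past `f` gives the sign `(-1)^i` rather than `(-1)^(ij)`. The two
differ only for `i = 1`, `j = 0`; there the products are odd and both sides vanish. -/
theorem isSupertrace_siteSupertrace : IsSupertrace (siteSupertrace hn hN hσ hν) := by
  intro i j f hf g hg
  have key : siteSupertrace hn hN hσ hν (f * g) =
      (-1 : ℂ) ^ i.val * siteSupertrace hn hN hσ hν (g * f) := by
    rw [siteSupertrace_apply, siteSupertrace_apply, map_mul (siteRep hn hN hσ hν),
      map_mul (siteRep hn hN hσ hν), ← mul_assoc,
      siteParity_mul_siteRep hf, smul_mul_assoc, map_smul, smul_eq_mul, mul_assoc,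
      LinearMap.trace_mul_comm, mul_assoc]
  rw [map_sub, map_smul, smul_eq_mul, sub_eq_zero]
  have h2 : ∀ j : ZMod 2, j = 0 ∨ j = 1 := by decide
  rcases h2 j with rfl | rfl
  · rcases h2 i with rfl | rfl
    · simpa [ZMod.val_zero] using key
    · rw [siteSupertrace_eq_zero (by simpa using mul_mem_parityPart hf hg),
        siteSupertrace_eq_zero (by simpa using mul_mem_parityPart hg hf), mul_zero]
  · simpa [ZMod.val_one] using key

/-- The parity operator is the action of an element of the algebra. -/
theorem exists_siteRep_eq_siteParity : ∃ κ, siteRep hn hN hσ hν κ = siteParity N := by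
  classical
  have hw : siteRep hn hN hσ hν
      (RingQuot.mkAlgHom ℂ (Rel n ν) (fa n 0 * fb n 1 + fa n 1 * fb n 0)) = _ :=
    siteRep_mk_eq_lmul (by
      simp only [map_add, map_mul, latRep_fa, latRep_fb]
      exact latA_mul_latB_add (N := (N : ℤ)) hn hσ)
  set w := RingQuot.mkAlgHom ℂ (Rel n ν) (fa n 0 * fb n 1 + fa n 1 * fb n 0)
  let s : Finset ℤ := (Finset.univ : Finset (sites N)).image fun p => N - 1 - |p.1.1| - 2 * p.1.2
  -- At the eigenvalue `j = N - 1 - |d| - 2i` the exponent `N - 1 - j` is `|d| + 2i`, which has the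
  -- parity of `d`.
  let P : Polynomial ℂ := Lagrange.interpolate s (fun j => (j : ℂ)) fun j => (-1) ^ (N - 1 - j)
  have hP : ∀ p : sites N, P.eval ((N - 1 - |p.1.1| - 2 * p.1.2 : ℤ) : ℂ) = (-1) ^ p.1.1 := by
    intro p
    refine (Lagrange.eval_interpolate_at_node (s := s)
      (i := (N : ℤ) - 1 - |p.1.1| - 2 * p.1.2) _ (fun a _ b _ h => by exact_mod_cast h)
      (Finset.mem_image_of_mem _ (Finset.mem_univ p))).trans ?_
    have h0 : (-1 : ℂ) ≠ 0 := by norm_num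
    rw [show (N : ℤ) - 1 - (N - 1 - |p.1.1| - 2 * p.1.2) = |p.1.1| + 2 * p.1.2 by ring,
      zpow_add₀ h0, zpow_mul]
    rcases abs_choice p.1.1 with h | h <;> rw [h]
    · norm_num
    · rw [zpow_neg, ← inv_zpow]
      norm_num
  refine ⟨Polynomial.aeval w P, ?_⟩
  rw [← Polynomial.aeval_algHom_apply, hw, Polynomial.aeval_algHom_apply, siteParity]
  congr 1
  ext p
  rw [← hP p]
  have := Polynomial.aeval_algHom_apply (Pi.evalAlgHom ℂ (fun _ : sites N => ℂ) p)
    (fun p => ((N : ℤ) : ℂ) - 1 - (|p.1.1| : ℤ) - 2 * (p.1.2 : ℂ)) P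
  refine this.symm.trans ?_
  simp [Polynomial.aeval_def, Polynomial.eval₂_eq_eval_map]

theorem trace_lmul_pi {ι : Type*} [Fintype ι] [DecidableEq ι] (f : ι → ℂ) :
    LinearMap.trace ℂ (ι → ℂ) (Algebra.lmul ℂ (ι → ℂ) f) = ∑ p, f p := by
  rw [LinearMap.trace_eq_matrix_trace ℂ (Pi.basisFun ℂ ι), Matrix.trace]
  refine Finset.sum_congr rfl fun p _ => ?_
  simp

/-- The substitution `d = p - q`, `i = min(p, q)` identifies the sites with the square `0 ≤ p, q <
N`, and the sum factors into two geometric sums. The multiplied form also covers `w = 1`. -/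
theorem sum_sites_zpow_mul (N : ℕ) {w : ℂ} (hw : w ≠ 0) :
    (∑ p : sites N, w ^ p.1.1) * ((1 - w) * (1 - w⁻¹)) = (1 - w ^ N) * (1 - w⁻¹ ^ N) := by
  have h : ∑ p : sites N, w ^ p.1.1 =
      (∑ p ∈ Finset.range N, w ^ p) * ∑ q ∈ Finset.range N, w⁻¹ ^ q := by
    rw [Finset.sum_coe_sort (sites N) fun p => w ^ p.1, Finset.sum_mul_sum,
      ← Finset.sum_product']
    refine Finset.sum_bij' (fun p _ => ((p.2 + max p.1 0).toNat, (p.2 + max (-p.1) 0).toNat))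
      (fun p _ => ((p.1 : ℤ) - p.2, min (p.1 : ℤ) p.2)) ?_ ?_ ?_ ?_ ?_
    · rintro ⟨d, i⟩ hp
      rw [mem_sites] at hp
      simp only [Finset.mem_product, Finset.mem_range]
      omega
    · rintro ⟨p, q⟩ hp
      rw [mem_sites]
      simp only [Finset.mem_product, Finset.mem_range] at hp
      omega
    · rintro ⟨d, i⟩ hp
      rw [mem_sites] at hp
      simp only [Prod.mk.injEq]
      omega
    · rintro ⟨p, q⟩ hp
      simp only [Prod.mk.injEq]
      omega
    · rintro ⟨d, i⟩ hp
      rw [mem_sites] at hp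
      simp only
      rw [← zpow_natCast, ← zpow_natCast, inv_zpow, ← zpow_neg, ← zpow_add₀ hw]
      congr 1
      omega
  rw [h, ← mul_neg_geom_sum w N, ← mul_neg_geom_sum w⁻¹ N]
  ring

end

end

end DihedralSRA

/-! ### Commutation rules and words of given length in the algebra -/

namespace DihedralSRA

noncomputable section

theorem eq_rot_or_eq_rot_mul {n : ℕ} (g : DihedralGroup n) :
    (∃ k, g = rot n k) ∨ ∃ k, g = rot n k * reflec n 0 := by
  rcases g with k | k
  · exact Or.inl ⟨k, rfl⟩
  · refine Or.inr ⟨-k, ?_⟩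
    rw [rot_mul_reflec, add_zero, reflec, neg_neg]

variable (n : ℕ) [NeZero n] (ν : ℂ)

/-- The images of the generators `a^α`, `b^α` and of the group elements in the algebra. -/
def genA (α : Fin 2) : SRA n ν := gen n ν (Gen.a α)

def genB (α : Fin 2) : SRA n ν := gen n ν (Gen.b α)

def genG (g : DihedralGroup n) : SRA n ν := gen n ν (Gen.grp g)

/-- The image of `L_p` in the algebra. -/
def imL (p : ZMod n) : SRA n ν := RingQuot.mkAlgHom ℂ (Rel n ν) (fL n p)

variable {n ν}

theorem sra_neg_mul (x y : SRA n ν) : -x * y = -(x * y) := neg_mul x y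

theorem sra_mul_neg (x y : SRA n ν) : x * -y = -(x * y) := mul_neg x y

theorem sra_smul_sub (c : ℂ) (x y : SRA n ν) : c • (x - y) = c • x - c • y := smul_sub c x y

theorem mk_eq_mk {x y : Free n} (h : Rel n ν x y) :
    RingQuot.mkAlgHom ℂ (Rel n ν) x = RingQuot.mkAlgHom ℂ (Rel n ν) y :=
  RingQuot.mkAlgHom_rel ℂ h

theorem mk_fa (α : Fin 2) : RingQuot.mkAlgHom ℂ (Rel n ν) (fa n α) = genA n ν α := rfl

theorem mk_fb (α : Fin 2) : RingQuot.mkAlgHom ℂ (Rel n ν) (fb n α) = genB n ν α := rfl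

theorem mk_fg (g : DihedralGroup n) : RingQuot.mkAlgHom ℂ (Rel n ν) (fg g) = genG n ν g := rfl

theorem mk_fL (p : ZMod n) : RingQuot.mkAlgHom ℂ (Rel n ν) (fL n p) = imL n ν p := rfl

theorem genG_one : genG n ν 1 = 1 := by
  rw [← mk_fg, mk_eq_mk Rel.grp_one, map_one]

theorem genG_mul (g h : DihedralGroup n) : genG n ν g * genG n ν h = genG n ν (g * h) := by
  rw [← mk_fg, ← mk_fg, ← map_mul, mk_eq_mk (Rel.grp_mul g h), mk_fg]

theorem genG_mul_inv (g : DihedralGroup n) : genG n ν g * genG n ν g⁻¹ = 1 := by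
  rw [genG_mul, mul_inv_cancel, genG_one]

theorem genG_inv_mul (g : DihedralGroup n) : genG n ν g⁻¹ * genG n ν g = 1 := by
  rw [genG_mul, inv_mul_cancel, genG_one]

theorem imL_eq (p : ZMod n) : imL n ν p =
    (1 / (n : ℂ)) • ∑ k : ZMod n, (ZMod.stdAddChar (k * p) : ℂ) • genG n ν (reflec n k) := by
  simp only [imL, fL, map_smul, map_sum, mk_fg]

theorem comm_genA_genB (α β : Fin 2) : genA n ν α * genB n ν β - genB n ν β * genA n ν α =
    eps α β • (1 + ((n : ℂ) * ν) • imL n ν 0) := by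
  have := mk_eq_mk (Rel.comm_ab (ν := ν) (n := n) α β)
  simpa only [map_sub, map_mul, map_smul, map_add, map_one, mk_fa, mk_fb, mk_fL] using this

theorem comm_genA_genA (α β : Fin 2) : genA n ν α * genA n ν β - genA n ν β * genA n ν α =
    eps α β • (((n : ℂ) * ν) • imL n ν 1) := by
  have := mk_eq_mk (Rel.comm_aa (ν := ν) (n := n) α β)
  simpa only [map_sub, map_mul, map_smul, mk_fa, mk_fL] using this

theorem comm_genB_genB (α β : Fin 2) : genB n ν α * genB n ν β - genB n ν β * genB n ν α =
    eps α β • (((n : ℂ) * ν) • imL n ν (-1)) := by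
  have := mk_eq_mk (Rel.comm_bb (ν := ν) (n := n) α β)
  simpa only [map_sub, map_mul, map_smul, mk_fb, mk_fL] using this

/-- Fourier inversion on `ℤ/n`. -/
theorem sum_stdAddChar_smul_dft {M : Type*} [AddCommGroup M] [Module ℂ M] (f : ZMod n → M)
    (k : ZMod n) :
    ∑ p : ZMod n, (ZMod.stdAddChar (p * k) : ℂ) •
      ((1 / (n : ℂ)) • ∑ l : ZMod n, (ZMod.stdAddChar (-(l * p)) : ℂ) • f l) = f k := by
  have h := congrFun (ZMod.dft.symm_apply_apply f) k
  rw [ZMod.invDFT_apply] at h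
  simp only [ZMod.dft_apply] at h
  rw [← h, Finset.smul_sum]
  exact Finset.sum_congr rfl fun p _ => by rw [smul_comm, one_div]

theorem sum_stdAddChar_smul_fQ (k : ZMod n) :
    ∑ p : ZMod n, (ZMod.stdAddChar (p * k) : ℂ) • fQ n p = fg (rot n k) :=
  sum_stdAddChar_smul_dft (fun l => fg (rot n l)) k

theorem sum_fL : ∑ p : ZMod n, fL n p = fg (reflec n 0) := by
  have h := sum_stdAddChar_smul_dft (fun l => fg (reflec n (-l))) (0 : ZMod n)
  simp only [mul_zero, AddChar.map_zero_eq_one, one_smul, neg_zero] at h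
  rw [← h]
  refine Finset.sum_congr rfl fun p _ => ?_
  rw [fL]
  congr 1
  refine Fintype.sum_equiv (Equiv.neg _) _ _ fun k => ?_
  simp

/-- Fourier inversion writes `S_k` as `∑ λ^(pk) Q_p`. The shift `p ↦ p + 1` in the relation for
`Q_p` then becomes the factor `λ^(-k)`. -/
theorem rot_mul_genA (k : ZMod n) (α : Fin 2) : genG n ν (rot n k) * genA n ν α =
    (ZMod.stdAddChar (-k) : ℂ) • (genA n ν α * genG n ν (rot n k)) := by
  have h : ∀ p : ZMod n, (RingQuot.mkAlgHom ℂ (Rel n ν) (fQ n p)) * genA n ν α =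
      genA n ν α * (RingQuot.mkAlgHom ℂ (Rel n ν) (fQ n (p + 1))) := fun p => by
    rw [← mk_fa, ← map_mul, mk_eq_mk (Rel.Q_a p α), map_mul]
  simp only [← mk_fg, ← sum_stdAddChar_smul_fQ, map_sum, map_smul, Finset.sum_mul, Finset.mul_sum,
    smul_mul_assoc, mul_smul_comm, h, Finset.smul_sum, smul_smul, ← AddChar.map_add_eq_mul]
  refine Fintype.sum_equiv (Equiv.addRight 1) _ _ fun p => ?_
  simp only [Equiv.coe_addRight]
  congr 2
  ring

theorem rot_mul_genB (k : ZMod n) (α : Fin 2) : genG n ν (rot n k) * genB n ν α =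
    (ZMod.stdAddChar k : ℂ) • (genB n ν α * genG n ν (rot n k)) := by
  have h : ∀ p : ZMod n, (RingQuot.mkAlgHom ℂ (Rel n ν) (fQ n p)) * genB n ν α =
      genB n ν α * (RingQuot.mkAlgHom ℂ (Rel n ν) (fQ n (p - 1))) := fun p => by
    rw [← mk_fb, ← map_mul, mk_eq_mk (Rel.Q_b p α), map_mul]
  simp only [← mk_fg, ← sum_stdAddChar_smul_fQ, map_sum, map_smul, Finset.sum_mul, Finset.mul_sum,
    smul_mul_assoc, mul_smul_comm, h, Finset.smul_sum, smul_smul, ← AddChar.map_add_eq_mul]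
  refine Fintype.sum_equiv (Equiv.subRight 1) _ _ fun p => ?_
  simp only [Equiv.subRight_apply]
  congr 2
  ring

/-- `R_0` is the sum of all `L_p`, and summing the relations over `p` absorbs the shift of the
index. -/
theorem reflec_zero_mul_genA (α : Fin 2) : genG n ν (reflec n 0) * genA n ν α =
    -(genB n ν α * genG n ν (reflec n 0)) := by
  have h : ∀ p : ZMod n, imL n ν p * genA n ν α = -(genB n ν α * imL n ν (p + 1)) := fun p => by
    rw [← mk_fa, imL, ← map_mul, mk_eq_mk (Rel.L_a p α), map_neg, map_mul, mk_fb, mk_fL]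
  simp only [← mk_fg, ← sum_fL, map_sum, Finset.sum_mul, Finset.mul_sum, mk_fL, h,
    Finset.sum_neg_distrib]
  exact congrArg _ (Fintype.sum_equiv (Equiv.addRight 1) _ _ fun p => rfl)

theorem reflec_zero_mul_genB (α : Fin 2) : genG n ν (reflec n 0) * genB n ν α =
    -(genA n ν α * genG n ν (reflec n 0)) := by
  have h : ∀ p : ZMod n, imL n ν p * genB n ν α = -(genA n ν α * imL n ν (p - 1)) := fun p => by
    rw [← mk_fb, imL, ← map_mul, mk_eq_mk (Rel.L_b p α), map_neg, map_mul, mk_fa, mk_fL]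
  simp only [← mk_fg, ← sum_fL, map_sum, Finset.sum_mul, Finset.mul_sum, mk_fL, h,
    Finset.sum_neg_distrib]
  exact congrArg _ (Fintype.sum_equiv (Equiv.subRight 1) _ _ fun p => rfl)

variable (n ν)

/-- The span of the generators `a^α` and `b^α`. -/
def vecSpan : Submodule ℂ (SRA n ν) :=
  Submodule.span ℂ (Set.range (genA n ν) ∪ Set.range (genB n ν))

variable {n} in
/-- The span of a set of group elements. -/
def grpSpan (Γ : Set (DihedralGroup n)) : Submodule ℂ (SRA n ν) :=
  Submodule.span ℂ (genG n ν '' Γ)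

/-- The span of the products of `e - 1` generators `a^α`, `b^α` and a group element. -/
def degPart : ℕ → Submodule ℂ (SRA n ν)
  | 0 => ⊥
  | e + 1 => vecSpan n ν ^ e * grpSpan ν Set.univ

variable {n ν}

theorem genA_mem (α : Fin 2) : genA n ν α ∈ vecSpan n ν :=
  Submodule.subset_span (Or.inl ⟨α, rfl⟩)

theorem genB_mem (α : Fin 2) : genB n ν α ∈ vecSpan n ν :=
  Submodule.subset_span (Or.inr ⟨α, rfl⟩)

theorem genG_mem {Γ : Set (DihedralGroup n)} {g : DihedralGroup n} (hg : g ∈ Γ) :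
    genG n ν g ∈ grpSpan ν Γ :=
  Submodule.subset_span ⟨g, hg, rfl⟩

theorem grpSpan_mono {Γ Δ : Set (DihedralGroup n)} (h : Γ ⊆ Δ) : grpSpan ν Γ ≤ grpSpan ν Δ :=
  Submodule.span_mono (Set.image_mono h)

theorem vecSpan_induction {p : (v : SRA n ν) → v ∈ vecSpan n ν → Prop}
    (ha : ∀ α, p (genA n ν α) (genA_mem α)) (hb : ∀ α, p (genB n ν α) (genB_mem α))
    (h0 : p 0 (zero_mem _)) (hadd : ∀ x y hx hy, p x hx → p y hy → p (x + y) (add_mem hx hy))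
    (hsmul : ∀ (c : ℂ) x hx, p x hx → p (c • x) (Submodule.smul_mem _ c hx)) {v : SRA n ν}
    (hv : v ∈ vecSpan n ν) : p v hv := by
  refine Submodule.span_induction (p := p) ?_ h0 hadd hsmul hv
  rintro _ (⟨α, rfl⟩ | ⟨α, rfl⟩)
  exacts [ha α, hb α]

theorem conj_rot_mem {v : SRA n ν} (hv : v ∈ vecSpan n ν) (k : ZMod n) :
    genG n ν (rot n k) * v * genG n ν (rot n k)⁻¹ ∈ vecSpan n ν := by
  induction hv using vecSpan_induction with
  | ha α =>
    rw [rot_mul_genA, smul_mul_assoc, mul_assoc, genG_mul_inv, mul_one]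
    exact Submodule.smul_mem _ _ (genA_mem α)
  | hb α =>
    rw [rot_mul_genB, smul_mul_assoc, mul_assoc, genG_mul_inv, mul_one]
    exact Submodule.smul_mem _ _ (genB_mem α)
  | h0 => simp
  | hadd x y _ _ hx hy =>
    rw [mul_add, add_mul]
    exact add_mem hx hy
  | hsmul c x _ hx =>
    rw [mul_smul_comm, smul_mul_assoc]
    exact Submodule.smul_mem _ _ hx

theorem conj_reflec_zero_mem {v : SRA n ν} (hv : v ∈ vecSpan n ν) :
    genG n ν (reflec n 0) * v * genG n ν (reflec n 0)⁻¹ ∈ vecSpan n ν := by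
  induction hv using vecSpan_induction with
  | ha α =>
    rw [reflec_zero_mul_genA, sra_neg_mul, mul_assoc, genG_mul_inv, mul_one]
    exact neg_mem (genB_mem α)
  | hb α =>
    rw [reflec_zero_mul_genB, sra_neg_mul, mul_assoc, genG_mul_inv, mul_one]
    exact neg_mem (genA_mem α)
  | h0 => simp
  | hadd x y _ _ hx hy =>
    rw [mul_add, add_mul]
    exact add_mem hx hy
  | hsmul c x _ hx =>
    rw [mul_smul_comm, smul_mul_assoc]
    exact Submodule.smul_mem _ _ hx

theorem conj_mem {v : SRA n ν} (hv : v ∈ vecSpan n ν) (g : DihedralGroup n) :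
    genG n ν g * v * genG n ν g⁻¹ ∈ vecSpan n ν := by
  rcases eq_rot_or_eq_rot_mul g with ⟨k, rfl⟩ | ⟨k, rfl⟩
  · exact conj_rot_mem hv k
  · have := conj_rot_mem (conj_reflec_zero_mem hv) k
    rw [mul_inv_rev, ← genG_mul, ← genG_mul]
    simpa only [mul_assoc] using this

theorem conj_pow_mem {e : ℕ} {y : SRA n ν} (hy : y ∈ vecSpan n ν ^ e) (g : DihedralGroup n) :
    genG n ν g * y * genG n ν g⁻¹ ∈ vecSpan n ν ^ e := by
  induction e generalizing y with
  | zero =>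
    rw [pow_zero, Submodule.mem_one] at hy ⊢
    obtain ⟨c, rfl⟩ := hy
    exact ⟨c, by rw [← Algebra.commutes, mul_assoc, genG_mul_inv, mul_one]⟩
  | succ e ih =>
    rw [pow_succ'] at hy ⊢
    induction hy using Submodule.mul_induction_on' with
    | mem_mul_mem v hv y hy =>
      have h : genG n ν g * (v * y) * genG n ν g⁻¹ =
          (genG n ν g * v * genG n ν g⁻¹) * (genG n ν g * y * genG n ν g⁻¹) := by
        simp only [mul_assoc]
        rw [← mul_assoc (genG n ν g⁻¹) (genG n ν g), genG_inv_mul, one_mul]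
      rw [h]
      exact Submodule.mul_mem_mul (conj_mem hv g) (ih hy)
    | add x _ y _ hx hy =>
      rw [mul_add, add_mul]
      exact add_mem hx hy

/-- Conjugation by group elements preserves the span of the generators, so a group element moves to
the right of a word without changing itself or the length of the word. -/
theorem grpSpan_mul_vecSpan_pow_le (Γ : Set (DihedralGroup n)) (e : ℕ) :
    grpSpan ν Γ * vecSpan n ν ^ e ≤ vecSpan n ν ^ e * grpSpan ν Γ := by
  rw [Submodule.mul_le]
  intro x hx y hy
  induction hx using Submodule.span_induction with
  | mem x hx =>
    obtain ⟨g, hg, rfl⟩ := hx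
    have h : genG n ν g * y = (genG n ν g * y * genG n ν g⁻¹) * genG n ν g := by
      rw [mul_assoc _ (genG n ν g⁻¹), genG_inv_mul, mul_one]
    rw [h]
    exact Submodule.mul_mem_mul (conj_pow_mem hy g) (genG_mem hg)
  | zero => simp
  | add x y _ _ hx hy =>
    rw [add_mul]
    exact add_mem hx hy
  | smul c x _ hx =>
    rw [smul_mul_assoc]
    exact Submodule.smul_mem _ _ hx

theorem grpSpan_univ_mul_self :
    grpSpan ν (Set.univ : Set (DihedralGroup n)) * grpSpan ν Set.univ ≤ grpSpan ν Set.univ := by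
  rw [grpSpan, Submodule.span_mul_span, Submodule.span_le]
  rintro _ ⟨_, ⟨g, -, rfl⟩, _, ⟨h, -, rfl⟩, rfl⟩
  exact Submodule.subset_span ⟨g * h, trivial, (genG_mul g h).symm⟩

theorem degPart_mul_grpSpan_le (e : ℕ) : degPart n ν e * grpSpan ν Set.univ ≤ degPart n ν e := by
  cases e with
  | zero => simp [degPart]
  | succ e =>
    rw [degPart, mul_assoc]
    exact mul_le_mul_right grpSpan_univ_mul_self _

theorem degPart_mul_vecSpan_pow_le (e i : ℕ) :
    degPart n ν e * vecSpan n ν ^ i ≤ degPart n ν (e + i) := by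
  cases e with
  | zero => simp [degPart]
  | succ e =>
    rw [Nat.succ_add, degPart, degPart, mul_assoc, pow_add, mul_assoc]
    exact mul_le_mul_right (grpSpan_mul_vecSpan_pow_le _ i) _

theorem vecSpan_mul_degPart_le (e : ℕ) : vecSpan n ν * degPart n ν e ≤ degPart n ν (e + 1) := by
  cases e with
  | zero => simp [degPart]
  | succ e => rw [degPart, degPart, ← mul_assoc, pow_succ']

theorem grpSpan_mul_degPart_le (e : ℕ) : grpSpan ν Set.univ * degPart n ν e ≤ degPart n ν e := by
  cases e with
  | zero => simp [degPart]
  | succ e =>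
    rw [degPart, ← mul_assoc]
    refine (mul_le_mul_left (grpSpan_mul_vecSpan_pow_le _ e) _).trans ?_
    rw [mul_assoc]
    exact mul_le_mul_right grpSpan_univ_mul_self _

theorem imL_mem (p : ZMod n) : imL n ν p ∈ grpSpan ν (Set.range (reflec n)) := by
  rw [imL_eq]
  exact Submodule.smul_mem _ _ (Submodule.sum_mem _ fun k _ =>
    Submodule.smul_mem _ _ (genG_mem ⟨k, rfl⟩))

theorem commutator_mem {v w : SRA n ν} (hv : v ∈ vecSpan n ν) (hw : w ∈ vecSpan n ν) :
    v * w - w * v ∈ grpSpan ν (Set.univ : Set (DihedralGroup n)) := by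
  have hL : ∀ p, imL n ν p ∈ grpSpan ν (Set.univ : Set (DihedralGroup n)) := fun p =>
    grpSpan_mono (Set.subset_univ _) (imL_mem p)
  have h1 : (1 : SRA n ν) ∈ grpSpan ν (Set.univ : Set (DihedralGroup n)) := by
    rw [← genG_one]
    exact genG_mem trivial
  have hab : ∀ α β, genA n ν α * genB n ν β - genB n ν β * genA n ν α ∈
      grpSpan ν (Set.univ : Set (DihedralGroup n)) := fun α β => by
    rw [comm_genA_genB]
    exact Submodule.smul_mem _ _ (add_mem h1 (Submodule.smul_mem _ _ (hL 0)))
  induction hv using vecSpan_induction with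
  | ha α =>
    induction hw using vecSpan_induction with
    | ha β =>
      rw [comm_genA_genA]
      exact Submodule.smul_mem _ _ (Submodule.smul_mem _ _ (hL _))
    | hb β => exact hab α β
    | h0 => simp
    | hadd x y _ _ hx hy =>
      rw [mul_add, add_mul, add_sub_add_comm]
      exact add_mem hx hy
    | hsmul c x _ hx =>
      rw [mul_smul_comm, smul_mul_assoc, ← sra_smul_sub]
      exact Submodule.smul_mem _ _ hx
  | hb α =>
    induction hw using vecSpan_induction with
    | ha β =>
      rw [← neg_sub]
      exact neg_mem (hab β α)
    | hb β =>
      rw [comm_genB_genB]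
      exact Submodule.smul_mem _ _ (Submodule.smul_mem _ _ (hL _))
    | h0 => simp
    | hadd x y _ _ hx hy =>
      rw [mul_add, add_mul, add_sub_add_comm]
      exact add_mem hx hy
    | hsmul c x _ hx =>
      rw [mul_smul_comm, smul_mul_assoc, ← sra_smul_sub]
      exact Submodule.smul_mem _ _ hx
  | h0 => simp
  | hadd x y _ _ hx hy =>
    rw [mul_add, add_mul, add_sub_add_comm]
    exact add_mem hx hy
  | hsmul c x _ hx =>
    rw [mul_smul_comm, smul_mul_assoc, ← sra_smul_sub]
    exact Submodule.smul_mem _ _ hx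

/-- A commutator of two generators lies in the group algebra, so commuting `v` past a word shortens
the product by two letters, from `e + 1` to `e - 1`. The index shift in `degPart`, with `degPart 0 =
⊥`, makes this correct for `e = 0` too. -/
theorem commutator_pow_mem {v : SRA n ν} (hv : v ∈ vecSpan n ν) {e : ℕ} {y : SRA n ν}
    (hy : y ∈ vecSpan n ν ^ e) : v * y - y * v ∈ degPart n ν e := by
  induction e generalizing y with
  | zero =>
    rw [pow_zero, Submodule.mem_one] at hy
    obtain ⟨c, rfl⟩ := hy
    rw [Algebra.commutes, sub_self]
    exact zero_mem _
  | succ e ih =>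
    rw [pow_succ'] at hy
    induction hy using Submodule.mul_induction_on' with
    | mem_mul_mem w hw y hy =>
      rw [show v * (w * y) - w * y * v = (v * w - w * v) * y + w * (v * y - y * v) by
        simp only [mul_sub, sub_mul, mul_assoc]; abel]
      refine add_mem ?_ (vecSpan_mul_degPart_le e (Submodule.mul_mem_mul hw (ih hy)))
      exact grpSpan_mul_vecSpan_pow_le _ e (Submodule.mul_mem_mul (commutator_mem hv hw) hy)
    | add x _ y _ hx hy =>
      rw [mul_add, add_mul, add_sub_add_comm]
      exact add_mem hx hy

/-- This is the spanning half of a PBW statement; linear independence is not needed, since it only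
serves to show that functionals vanish. -/
theorem mem_iSup_degPart (x : SRA n ν) : x ∈ ⨆ e, degPart n ν e := by
  have key : ∀ (f : Free n) (y : SRA n ν), y ∈ ⨆ e, degPart n ν e →
      RingQuot.mkAlgHom ℂ (Rel n ν) f * y ∈ ⨆ e, degPart n ν e := by
    intro f
    induction f using FreeAlgebra.induction with
    | grade0 r =>
      intro y hy
      rw [AlgHom.commutes, ← Algebra.smul_def]
      exact Submodule.smul_mem _ _ hy
    | grade1 g =>
      intro y hy
      have hV : ∀ v ∈ vecSpan n ν, v * y ∈ ⨆ e, degPart n ν e := by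
        intro v hv
        induction hy using Submodule.iSup_induction' with
        | mem e y hy =>
          exact Submodule.mem_iSup_of_mem (e + 1)
            (vecSpan_mul_degPart_le e (Submodule.mul_mem_mul hv hy))
        | zero => simp
        | add x y _ _ hx hy =>
          rw [mul_add]
          exact add_mem hx hy
      rcases g with α | α | g
      · exact hV _ (genA_mem α)
      · exact hV _ (genB_mem α)
      · clear hV
        induction hy using Submodule.iSup_induction' with
        | mem e y hy =>
          exact Submodule.mem_iSup_of_mem e
            (grpSpan_mul_degPart_le e (Submodule.mul_mem_mul (genG_mem (Set.mem_univ g)) hy))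
        | zero => simp
        | add x y _ _ hx hy =>
          rw [mul_add]
          exact add_mem hx hy
    | mul a b ha hb =>
      intro y hy
      rw [map_mul, mul_assoc]
      exact ha _ (hb _ hy)
    | add a b ha hb =>
      intro y hy
      rw [map_add, add_mul]
      exact add_mem (ha _ hy) (hb _ hy)
  obtain ⟨f, rfl⟩ := RingQuot.mkAlgHom_surjective ℂ (Rel n ν) x
  rw [← mul_one (RingQuot.mkAlgHom ℂ (Rel n ν) f)]
  refine key f 1 (Submodule.mem_iSup_of_mem 1 ?_)
  rw [degPart, pow_zero, one_mul, ← genG_one]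
  exact genG_mem trivial

end

end DihedralSRA

/-! ### Vanishing of cyclic functionals on words of fixed length -/

namespace DihedralSRA

noncomputable section

variable {n : ℕ} [NeZero n] {ν : ℂ}

/-- In degree `e` the functional `t` is invariant under conjugation, and moving a generator `a^α` or
`b^α` around produces the factor `η`. -/
structure IsCyclicAt (t : SRA n ν →ₗ[ℂ] ℂ) (η : ℂ) (e : ℕ) : Prop where
  low : ∀ v ∈ vecSpan n ν, ∀ y ∈ degPart n ν e, t (v * y) = η * t (y * v)
  high : ∀ v ∈ vecSpan n ν, ∀ y ∈ degPart n ν (e + 2), t (v * y) = η * t (y * v)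
  conj : ∀ g, ∀ y ∈ degPart n ν (e + 1), t (genG n ν g * y * genG n ν g⁻¹) = t y

theorem mul_genG_mem {e : ℕ} {y : SRA n ν} (hy : y ∈ vecSpan n ν ^ e) (g : DihedralGroup n) :
    y * genG n ν g ∈ degPart n ν (e + 1) :=
  Submodule.mul_mem_mul hy (genG_mem trivial)

theorem degPart_mul_genG_mem {e : ℕ} {y : SRA n ν} (hy : y ∈ degPart n ν e)
    (g : DihedralGroup n) : y * genG n ν g ∈ degPart n ν e :=
  degPart_mul_grpSpan_le e (Submodule.mul_mem_mul hy (genG_mem trivial))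

/-- Words in generators that are not fixed by a rotation do not contribute. -/
theorem IsCyclicAt.apply_mul_rot_eq_zero {t : SRA n ν →ₗ[ℂ] ℂ} {η : ℂ} {e : ℕ}
    (h : IsCyclicAt t η (e + 1)) (hlow : ∀ y ∈ degPart n ν e, t y = 0) {k : ZMod n}
    (h1 : η * ZMod.stdAddChar (-k) ≠ 1) (h2 : η * ZMod.stdAddChar k ≠ 1) {y : SRA n ν}
    (hy : y ∈ vecSpan n ν ^ (e + 1)) : t (y * genG n ν (rot n k)) = 0 := by
  have key : ∀ (c : ℂ) (v y : SRA n ν), v ∈ vecSpan n ν → y ∈ vecSpan n ν ^ e → η * c ≠ 1 →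
      genG n ν (rot n k) * v = c • (v * genG n ν (rot n k)) →
      t (v * y * genG n ν (rot n k)) = 0 := by
    intro c v y hv hy hc hS
    -- Taking `v` around cyclically and back through `S_k` yields the factor `η c`. Reordering `v y`
    -- into `y v` costs only shorter words, on which `t` vanishes, so `(1 - η c) t = 0`.
    have e1 : t (v * y * genG n ν (rot n k)) = η * (c * t (y * v * genG n ν (rot n k))) := by
      rw [mul_assoc, h.low v hv _ (mul_genG_mem hy _), mul_assoc y, hS, mul_smul_comm, map_smul,
        smul_eq_mul, mul_assoc y]
    have e2 : t (v * y * genG n ν (rot n k)) - t (y * v * genG n ν (rot n k)) = 0 := by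
      rw [← map_sub, ← sub_mul]
      exact hlow _ (degPart_mul_genG_mem (commutator_pow_mem hv hy) _)
    have e3 : (1 - η * c) * t (v * y * genG n ν (rot n k)) = 0 := by
      linear_combination e1 - η * c * e2
    exact (mul_eq_zero.mp e3).resolve_left (sub_ne_zero.mpr hc.symm)
  rw [pow_succ'] at hy
  induction hy using Submodule.mul_induction_on' with
  | mem_mul_mem v hv y hy =>
    induction hv using vecSpan_induction with
    | ha α => exact key _ _ _ (genA_mem α) hy h1 (rot_mul_genA k α)
    | hb α => exact key _ _ _ (genB_mem α) hy h2 (rot_mul_genB k α)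
    | h0 => simp
    | hadd x y _ _ hx hy => rw [add_mul, add_mul, map_add, hx, hy, add_zero]
    | hsmul c x _ hx => rw [smul_mul_assoc, smul_mul_assoc, map_smul, hx, smul_zero]
  | add x _ y _ hx hy => rw [add_mul, map_add, hx, hy, add_zero]

/-- Reordering words so that the powers of `c` come first. -/
theorem pow_vecSpan_le_of_ordered {c : SRA n ν} {U : Submodule ℂ (SRA n ν)}
    (hc : c ∈ vecSpan n ν) (hU : U ≤ vecSpan n ν)
    (hV : vecSpan n ν ≤ Submodule.span ℂ {c} ⊔ U) (e : ℕ) (T : Submodule ℂ (SRA n ν))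
    (hlow : degPart n ν (e - 1) ≤ T) (hT : ∀ j i, j + i = e → ∀ r ∈ U ^ i, c ^ j * r ∈ T) :
    vecSpan n ν ^ e ≤ T := by
  induction e generalizing T with
  | zero =>
    intro y hy
    simpa using hT 0 0 rfl y (by simpa using hy)
  | succ e ih =>
    have hcT : ∀ y ∈ vecSpan n ν ^ e, c * y ∈ T := by
      refine ih (T.comap (LinearMap.mulLeft ℂ c)) ?_ ?_
      · intro y hy
        refine hlow ?_
        cases e with
        | zero => simp_all [degPart]
        | succ e => exact vecSpan_mul_degPart_le _ (Submodule.mul_mem_mul hc hy)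
      · intro j i hji r hr
        have := hT (j + 1) i (by omega) r hr
        rwa [pow_succ', mul_assoc] at this
    have huT : ∀ u ∈ U, ∀ y ∈ vecSpan n ν ^ e, u * y ∈ T := by
      intro u hu
      refine ih (T.comap (LinearMap.mulLeft ℂ u)) ?_ ?_
      · intro y hy
        refine hlow ?_
        cases e with
        | zero => simp_all [degPart]
        | succ e => exact vecSpan_mul_degPart_le _ (Submodule.mul_mem_mul (hU hu) hy)
      · intro j i hji r hr
        have h1 := hT j (i + 1) (by omega) (u * r) (by
          rw [pow_succ']; exact Submodule.mul_mem_mul hu hr)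
        -- Moving `u` past `c^j` leaves a remainder shorter by two letters, which `T` contains.
        have h2 : (u * c ^ j - c ^ j * u) * r ∈ degPart n ν e := by
          rw [← hji]
          exact degPart_mul_vecSpan_pow_le j i (Submodule.mul_mem_mul
            (commutator_pow_mem (hU hu) (Submodule.pow_mem_pow _ hc j))
            (pow_le_pow_left' hU i hr))
        have h3 := add_mem h1 (hlow h2)
        rw [sub_mul, mul_assoc, mul_assoc, add_sub_cancel] at h3
        exact h3
    rw [pow_succ', Submodule.mul_le]
    intro v hv y hy
    obtain ⟨w, hw, u, hu, rfl⟩ := Submodule.mem_sup.mp (hV hv)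
    obtain ⟨s, rfl⟩ := Submodule.mem_span_singleton.mp hw
    rw [add_mul, smul_mul_assoc]
    exact add_mem (Submodule.smul_mem _ _ (hcT y hy)) (huT u hu y hy)

/-- If the commutators with `v` of the generators are a nonzero number for one of them and
lie in the span of `Γ` otherwise, then a functional vanishing on commutators with `v` and on
the span of `Γ` vanishes. -/
theorem apply_eq_zero_of_commutator {Γ : Set (DihedralGroup n)} {v c : SRA n ν}
    {U : Submodule ℂ (SRA n ν)} {ω : ℂ} (hω : ω ≠ 0) (hc : c ∈ vecSpan n ν) (hU : U ≤ vecSpan n ν)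
    (hV : vecSpan n ν ≤ Submodule.span ℂ {c} ⊔ U)
    (hvc : v * c - c * v - algebraMap ℂ _ ω ∈ grpSpan ν Γ)
    (hvU : ∀ u ∈ U, v * u - u * v ∈ grpSpan ν Γ) {e : ℕ} {t : SRA n ν →ₗ[ℂ] ℂ}
    (hlow : ∀ y ∈ degPart n ν (e - 1), t y = 0)
    (ht : ∀ x ∈ vecSpan n ν ^ (e + 1), t (v * x - x * v) = 0)
    (hΓ : ∀ y ∈ vecSpan n ν ^ e * grpSpan ν Γ, t y = 0) {y : SRA n ν}
    (hy : y ∈ vecSpan n ν ^ e) : t y = 0 := by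
  have hcomm : ∀ i : ℕ, grpSpan ν Γ * vecSpan n ν ^ i ≤ vecSpan n ν ^ i * grpSpan ν Γ :=
    grpSpan_mul_vecSpan_pow_le Γ
  -- The commutator with `v` acts on powers of `c` like `ω` times the derivative in `c`, modulo
  -- words followed by elements of `Γ`.
  have hpow : ∀ j : ℕ, v * c ^ (j + 1) - c ^ (j + 1) * v - ((j + 1 : ℂ) * ω) • c ^ j ∈
      vecSpan n ν ^ j * grpSpan ν Γ := by
    intro j
    induction j with
    | zero => simpa [Algebra.algebraMap_eq_smul_one] using hvc
    | succ j ih =>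
      have h1 : (v * c - c * v - algebraMap ℂ _ ω) * c ^ (j + 1) ∈
          vecSpan n ν ^ (j + 1) * grpSpan ν Γ :=
        hcomm _ (Submodule.mul_mem_mul hvc (Submodule.pow_mem_pow _ hc _))
      have h2 : c * (v * c ^ (j + 1) - c ^ (j + 1) * v - ((j + 1 : ℂ) * ω) • c ^ j) ∈
          vecSpan n ν ^ (j + 1) * grpSpan ν Γ := by
        rw [pow_succ', mul_assoc]
        exact Submodule.mul_mem_mul hc ih
      have h3 := add_mem h1 h2
      have h4 : v * c ^ (j + 1 + 1) - c ^ (j + 1 + 1) * v -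
          (((j + 1 : ℕ) + 1 : ℂ) * ω) • c ^ (j + 1) =
          (v * c - c * v - algebraMap ℂ _ ω) * c ^ (j + 1) +
          c * (v * c ^ (j + 1) - c ^ (j + 1) * v - ((j + 1 : ℂ) * ω) • c ^ j) := by
        have h5 : (((j + 1 : ℕ) + 1 : ℂ) * ω) • c ^ (j + 1) =
            ω • c ^ (j + 1) + ((j + 1 : ℂ) * ω) • c ^ (j + 1) := by
          rw [← add_smul]
          congr 1
          push_cast
          ring
        rw [h5, Algebra.algebraMap_eq_smul_one]
        simp only [mul_sub, sub_mul, smul_mul_assoc, one_mul, mul_smul_comm, ← pow_succ', mul_assoc]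
        rw [pow_succ' c (j + 1)]
        simp only [mul_assoc]
        abel
      rw [h4]
      exact h3
  have hUpow : ∀ i : ℕ, ∀ r ∈ U ^ (i + 1), v * r - r * v ∈ vecSpan n ν ^ i * grpSpan ν Γ := by
    intro i
    induction i with
    | zero =>
      intro r hr
      rw [zero_add, pow_one] at hr
      rw [pow_zero, one_mul]
      exact hvU r hr
    | succ i ih =>
      intro r hr
      rw [pow_succ'] at hr
      induction hr using Submodule.mul_induction_on' with
      | mem_mul_mem u hu r hr =>
        rw [show v * (u * r) - u * r * v = (v * u - u * v) * r + u * (v * r - r * v) by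
          simp only [mul_sub, sub_mul, mul_assoc]; abel]
        refine add_mem (hcomm _ (Submodule.mul_mem_mul (hvU u hu)
          (pow_le_pow_left' hU _ hr))) ?_
        rw [pow_succ', mul_assoc]
        exact Submodule.mul_mem_mul (hU hu) (ih r hr)
      | add x _ y _ hx hy =>
        rw [mul_add, add_mul, add_sub_add_comm]
        exact add_mem hx hy
  -- It suffices to treat the ordered words `c^j r`. Such a word is, up to the factor `(j + 1) ω`
  -- and terms killed by `t`, the commutator of `v` with its antiderivative `c^(j+1) r`.
  refine pow_vecSpan_le_of_ordered hc hU hV e (LinearMap.ker t) hlow ?_ hy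
  rintro j i rfl r hr
  rw [LinearMap.mem_ker]
  have h1 := ht (c ^ (j + 1) * r) (by
    rw [show j + i + 1 = j + 1 + i by ring, pow_add]
    exact Submodule.mul_mem_mul (Submodule.pow_mem_pow _ hc _) (pow_le_pow_left' hU _ hr))
  have h2 : t ((v * c ^ (j + 1) - c ^ (j + 1) * v - ((j + 1 : ℂ) * ω) • c ^ j) * r) = 0 := by
    refine hΓ _ ?_
    have := Submodule.mul_mem_mul (hpow j) (pow_le_pow_left' hU _ hr)
    rw [mul_assoc] at this
    rw [pow_add, mul_assoc]
    exact mul_le_mul_right (hcomm i) _ this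
  have h3 : t (c ^ (j + 1) * (v * r - r * v)) = 0 := by
    cases i with
    | zero =>
      rw [pow_zero, Submodule.mem_one] at hr
      obtain ⟨s, rfl⟩ := hr
      rw [Algebra.commutes, sub_self, mul_zero, map_zero]
    | succ i =>
      refine hΓ _ ?_
      rw [show j + (i + 1) = j + 1 + i by ring, pow_add, mul_assoc]
      exact Submodule.mul_mem_mul (Submodule.pow_mem_pow _ hc _) (hUpow i r hr)
  have h4 : v * (c ^ (j + 1) * r) - c ^ (j + 1) * r * v =
      (v * c ^ (j + 1) - c ^ (j + 1) * v - ((j + 1 : ℂ) * ω) • c ^ j) * r +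
      c ^ (j + 1) * (v * r - r * v) + ((j + 1 : ℂ) * ω) • (c ^ j * r) := by
    simp only [mul_sub, sub_mul, smul_mul_assoc, mul_assoc]
    abel
  rw [h4, map_add, map_add, h2, h3, map_smul, smul_eq_mul, zero_add, zero_add] at h1
  refine (mul_eq_zero.mp h1).resolve_left (mul_ne_zero ?_ hω)
  exact_mod_cast Nat.succ_ne_zero j

end

end DihedralSRA

/-! ### Uniqueness of traces and supertraces -/

namespace DihedralSRA

noncomputable section

variable {n : ℕ} [NeZero n] {ν : ℂ}

/-- A version of `apply_eq_zero_of_commutator` for words followed by a group element. -/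
theorem apply_mul_genG_eq_zero {Γ : Set (DihedralGroup n)} {v c : SRA n ν}
    {U : Submodule ℂ (SRA n ν)} {ω : ℂ} (hω : ω ≠ 0) (hc : c ∈ vecSpan n ν) (hU : U ≤ vecSpan n ν)
    (hV : vecSpan n ν ≤ Submodule.span ℂ {c} ⊔ U)
    (hvc : v * c - c * v - algebraMap ℂ _ ω ∈ grpSpan ν Γ)
    (hvU : ∀ u ∈ U, v * u - u * v ∈ grpSpan ν Γ) {e : ℕ} {t : SRA n ν →ₗ[ℂ] ℂ}
    {g : DihedralGroup n} (hlow : ∀ y ∈ degPart n ν (e - 1), t y = 0)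
    (ht : ∀ x ∈ vecSpan n ν ^ (e + 1), t (v * x * genG n ν g) = t (x * v * genG n ν g))
    (hΓ : ∀ y ∈ vecSpan n ν ^ e, ∀ γ ∈ Γ, t (y * genG n ν (γ * g)) = 0) {y : SRA n ν}
    (hy : y ∈ vecSpan n ν ^ e) : t (y * genG n ν g) = 0 := by
  refine apply_eq_zero_of_commutator (t := t ∘ₗ LinearMap.mulRight ℂ (genG n ν g)) hω hc hU hV hvc
    hvU (fun y hy => hlow _ (degPart_mul_genG_mem hy g)) (fun x hx => ?_) (fun y hy => ?_) hy
  · change t ((v * x - x * v) * genG n ν g) = 0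
    rw [sub_mul, map_sub, ht x hx, sub_self]
  · change t (y * genG n ν g) = 0
    induction hy using Submodule.mul_induction_on' with
    | mem_mul_mem y hy r hr =>
      induction hr using Submodule.span_induction with
      | mem r hr =>
        obtain ⟨γ, hγ, rfl⟩ := hr
        rw [mul_assoc, genG_mul]
        exact hΓ y hy γ hγ
      | zero => simp
      | add a b _ _ ha hb => rw [mul_add, add_mul, map_add, ha, hb, add_zero]
      | smul s a _ ha => rw [mul_smul_comm, smul_mul_assoc, map_smul, ha, smul_zero]
    | add a _ b _ ha hb => rw [add_mul, map_add, ha, hb, add_zero]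

omit [NeZero n] in
theorem exists_add_self_eq (hn : Odd n) (k : ZMod n) : ∃ j, j + j = k := by
  obtain ⟨m, hm⟩ := hn
  -- `m + 1` is the inverse of `2` modulo `2m + 1`.
  refine ⟨k * (m + 1), ?_⟩
  have h : ((2 * m + 1 : ℕ) : ZMod n) = 0 := by rw [← hm, ZMod.natCast_self]
  push_cast at h
  linear_combination k * h

theorem stdAddChar_ne_one {k : ZMod n} (hk : k ≠ 0) : (ZMod.stdAddChar k : ℂ) ≠ 1 := fun h =>
  hk (ZMod.injective_stdAddChar (h.trans (AddChar.map_zero_eq_one _).symm))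

theorem neg_one_mul_stdAddChar_ne_one (hn : Odd n) (k : ZMod n) :
    -1 * (ZMod.stdAddChar k : ℂ) ≠ 1 := by
  intro h
  have h1 : (ZMod.stdAddChar k : ℂ) ^ n = 1 := by
    rw [← AddChar.map_nsmul_eq_pow, nsmul_eq_mul, ZMod.natCast_self, zero_mul,
      AddChar.map_zero_eq_one]
  have h2 : (ZMod.stdAddChar k : ℂ) = -1 := by linear_combination -h
  rw [h2, hn.neg_one_pow] at h1
  norm_num at h1

/-- For odd `n` the reflections form one conjugacy class: `S_j R_0 S_j⁻¹ = R_{2j}`, and every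
residue is some `2j`. -/
theorem IsCyclicAt.apply_mul_reflec_eq_zero {t : SRA n ν →ₗ[ℂ] ℂ} {η : ℂ} {e : ℕ}
    (h : IsCyclicAt t η e) (hn : Odd n)
    (h0 : ∀ y ∈ vecSpan n ν ^ e, t (y * genG n ν (reflec n 0)) = 0) (k : ZMod n) {y : SRA n ν}
    (hy : y ∈ vecSpan n ν ^ e) : t (y * genG n ν (reflec n k)) = 0 := by
  obtain ⟨j, rfl⟩ := exists_add_self_eq hn k
  have hy' := conj_pow_mem hy (rot n j)⁻¹
  rw [inv_inv] at hy'
  have h1 := h.conj (rot n j) _ (mul_genG_mem hy' (reflec n 0))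
  rw [h0 _ hy'] at h1
  rw [← h1]
  congr 1
  have hg : rot n j * (reflec n 0 * (rot n j)⁻¹) = reflec n (j + j) := by
    rw [← mul_assoc, rot_mul_reflec, add_zero, mul_inv_eq_iff_eq_mul, reflec_mul_rot,
      add_sub_cancel_right]
  rw [← hg]
  simp only [← genG_mul, mul_assoc]
  rw [← mul_assoc (genG n ν (rot n j)) (genG n ν (rot n j)⁻¹), genG_mul_inv, one_mul]

theorem eq_zero_of_mem_degPart {t : SRA n ν →ₗ[ℂ] ℂ} {e : ℕ}
    (hrot : ∀ k, ∀ y ∈ vecSpan n ν ^ e, t (y * genG n ν (rot n k)) = 0)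
    (hreflec : ∀ k, ∀ y ∈ vecSpan n ν ^ e, t (y * genG n ν (reflec n k)) = 0) {y : SRA n ν}
    (hy : y ∈ degPart n ν (e + 1)) : t y = 0 := by
  induction hy using Submodule.mul_induction_on' with
  | mem_mul_mem y hy r hr =>
    induction hr using Submodule.span_induction with
    | mem r hr =>
      obtain ⟨g, -, rfl⟩ := hr
      rcases eq_rot_or_eq_rot_mul g with ⟨k, rfl⟩ | ⟨k, rfl⟩
      · exact hrot k y hy
      · rw [rot_mul_reflec]
        exact hreflec _ y hy
    | zero => simp
    | add a b _ _ ha hb => rw [mul_add, map_add, ha, hb, add_zero]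
    | smul s a _ ha => rw [mul_smul_comm, map_smul, ha, smul_zero]
  | add a _ b _ ha hb => rw [map_add, ha, hb, add_zero]

/-- `R_0` enters every `L_p` with the same coefficient `1/n`, so it cancels in the difference. -/
theorem imL_sub_imL_zero_mem (p : ZMod n) :
    imL n ν p - imL n ν 0 ∈ grpSpan ν (reflec n '' {0}ᶜ) := by
  rw [imL_eq, imL_eq, ← sra_smul_sub, ← Finset.sum_sub_distrib]
  refine Submodule.smul_mem _ _ (Submodule.sum_mem _ fun k _ => ?_)
  by_cases hk : k = 0
  · simp [hk]
  · exact sub_mem (Submodule.smul_mem _ _ (genG_mem ⟨k, hk, rfl⟩))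
      (Submodule.smul_mem _ _ (genG_mem ⟨k, hk, rfl⟩))

theorem vecSpan_le_of_add_sub_mem {W : Submodule ℂ (SRA n ν)}
    (hp : ∀ α, genA n ν α + genB n ν α ∈ W) (hm : ∀ α, genA n ν α - genB n ν α ∈ W) :
    vecSpan n ν ≤ W := by
  rw [vecSpan, Submodule.span_le]
  have h2 : ∀ x : SRA n ν, x + x ∈ W → x ∈ W := fun x hx => by
    have := W.smul_mem (1 / 2 : ℂ) hx
    rwa [← two_smul ℂ x, smul_smul, one_div, inv_mul_cancel₀ two_ne_zero, one_smul] at this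
  rintro _ (⟨α, rfl⟩ | ⟨α, rfl⟩)
  · refine h2 _ ?_
    have := add_mem (hp α) (hm α)
    rwa [show genA n ν α + genB n ν α + (genA n ν α - genB n ν α) = genA n ν α + genA n ν α by
      abel] at this
  · refine h2 _ ?_
    have := sub_mem (hp α) (hm α)
    rwa [show genA n ν α + genB n ν α - (genA n ν α - genB n ν α) = genB n ν α + genB n ν α by
      abel] at this

theorem genA_zero_mul_genA_one_sub : genA n ν 0 * genA n ν 1 - genA n ν 1 * genA n ν 0 =
    ((n : ℂ) * ν) • imL n ν 1 := by
  simpa [eps] using comm_genA_genA (n := n) (ν := ν) 0 1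

theorem genB_zero_mul_genB_one_sub : genB n ν 0 * genB n ν 1 - genB n ν 1 * genB n ν 0 =
    ((n : ℂ) * ν) • imL n ν (-1) := by
  simpa [eps] using comm_genB_genB (n := n) (ν := ν) 0 1

theorem genA_zero_mul_genB_one_sub : genA n ν 0 * genB n ν 1 - genB n ν 1 * genA n ν 0 =
    1 + ((n : ℂ) * ν) • imL n ν 0 := by
  simpa [eps] using comm_genA_genB (n := n) (ν := ν) 0 1

theorem genB_zero_mul_genA_one_sub : genB n ν 0 * genA n ν 1 - genA n ν 1 * genB n ν 0 =
    1 + ((n : ℂ) * ν) • imL n ν 0 := by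
  have h := congrArg Neg.neg (comm_genA_genB (n := n) (ν := ν) 1 0)
  rw [neg_sub] at h
  rw [h]
  change -((-1 : ℂ) • _) = _
  rw [show ∀ x : SRA n ν, (-1 : ℂ) • x = -x from fun x => neg_one_smul ℂ x]
  exact neg_neg _

theorem genA_mul_genB_self (α : Fin 2) : genA n ν α * genB n ν α = genB n ν α * genA n ν α := by
  have h := comm_genA_genB (n := n) (ν := ν) α α
  have h0 : eps α α = 0 := by fin_cases α <;> simp [eps]
  rw [h0, zero_smul] at h
  exact sub_eq_zero.mp h

theorem commutator_mem_of_mem_span {v : SRA n ν} {s : Set (SRA n ν)}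
    {X : Submodule ℂ (SRA n ν)} (h : ∀ u ∈ s, v * u - u * v ∈ X) :
    ∀ u ∈ Submodule.span ℂ s, v * u - u * v ∈ X := by
  intro u hu
  induction hu using Submodule.span_induction with
  | mem u hu => exact h u hu
  | zero => simp
  | add a b _ _ ha hb =>
    rw [mul_add, add_mul, add_sub_add_comm]
    exact add_mem ha hb
  | smul c a _ ha =>
    rw [mul_smul_comm, smul_mul_assoc, ← sra_smul_sub]
    exact Submodule.smul_mem _ _ ha

/-- A functional that is cyclic with factor `1` in degree `e` and vanishes in degree `e - 2`
vanishes in degree `e`, provided that it vanishes on the nontrivial rotations if `e = 0`. -/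
theorem IsCyclicAt.eq_zero_of_one {t : SRA n ν →ₗ[ℂ] ℂ} {e : ℕ} (h : IsCyclicAt t 1 e)
    (hn : Odd n) (hlow : ∀ y ∈ degPart n ν (e - 1), t y = 0)
    (hS : e = 0 → ∀ k ≠ 0, t (genG n ν (rot n k)) = 0) {y : SRA n ν}
    (hy : y ∈ degPart n ν (e + 1)) : t y = 0 := by
  have hrot : ∀ k ≠ 0, ∀ y ∈ vecSpan n ν ^ e, t (y * genG n ν (rot n k)) = 0 := by
    intro k hk y hy
    cases e with
    | zero =>
      rw [pow_zero, Submodule.mem_one] at hy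
      obtain ⟨s, rfl⟩ := hy
      rw [← Algebra.smul_def, map_smul, hS rfl k hk, smul_zero]
    | succ e =>
      refine h.apply_mul_rot_eq_zero hlow ?_ ?_ hy <;> rw [one_mul]
      exacts [stdAddChar_ne_one (neg_ne_zero.mpr hk), stdAddChar_ne_one hk]
  have hreflec : ∀ k, ∀ y ∈ vecSpan n ν ^ e, t (y * genG n ν (reflec n k)) = 0 := by
    intro k y hy
    refine h.apply_mul_reflec_eq_zero hn (fun y hy => ?_) k hy
    have hX : ∀ p, ((n : ℂ) * ν) • (imL n ν p - imL n ν 0) ∈ grpSpan ν (reflec n '' {0}ᶜ) :=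
      fun p => Submodule.smul_mem _ _ (imL_sub_imL_zero_mem p)
    -- `R_0` commutes with `a^α - b^α`, so `t` kills commutators with `v` followed by `R_0`. The
    -- commutator of `v` with `a^1 - b^1` is `-2 + μ (L_1 + L_{-1} - 2 L_0)`, which is free of
    -- `R_0`. Times `R_0` the remaining reflections become nontrivial rotations, settled by `hrot`;
    -- a term in the identity, not yet settled, never appears.
    refine apply_mul_genG_eq_zero (Γ := reflec n '' {0}ᶜ) (v := genA n ν 0 - genB n ν 0)
      (c := genA n ν 1 - genB n ν 1) (ω := -2)
      (U := Submodule.span ℂ {genA n ν 0 - genB n ν 0, genA n ν 0 + genB n ν 0,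
        genA n ν 1 + genB n ν 1}) (by norm_num) (sub_mem (genA_mem 1) (genB_mem 1)) ?_ ?_ ?_ ?_
      hlow ?_ ?_ hy
    · rw [Submodule.span_le]
      rintro _ (rfl | rfl | rfl)
      exacts [sub_mem (genA_mem 0) (genB_mem 0), add_mem (genA_mem 0) (genB_mem 0),
        add_mem (genA_mem 1) (genB_mem 1)]
    · refine vecSpan_le_of_add_sub_mem (fun α => ?_) fun α => ?_
      · refine Submodule.mem_sup_right (Submodule.subset_span ?_)
        fin_cases α <;> simp
      · fin_cases α
        · exact Submodule.mem_sup_right (Submodule.subset_span (by simp))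
        · exact Submodule.mem_sup_left (Submodule.mem_span_singleton_self _)
    · have e1 : (genA n ν 0 - genB n ν 0) * (genA n ν 1 - genB n ν 1) -
          (genA n ν 1 - genB n ν 1) * (genA n ν 0 - genB n ν 0) =
          (genA n ν 0 * genA n ν 1 - genA n ν 1 * genA n ν 0) -
          (genA n ν 0 * genB n ν 1 - genB n ν 1 * genA n ν 0) -
          (genB n ν 0 * genA n ν 1 - genA n ν 1 * genB n ν 0) +
          (genB n ν 0 * genB n ν 1 - genB n ν 1 * genB n ν 0) := by
        simp only [mul_sub, sub_mul]
        abel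
      have e2 := add_mem (hX 1) (hX (-1))
      rw [e1, genA_zero_mul_genA_one_sub, genA_zero_mul_genB_one_sub, genB_zero_mul_genA_one_sub,
        genB_zero_mul_genB_one_sub, map_neg, map_ofNat]
      rw [sra_smul_sub, sra_smul_sub] at e2
      convert e2 using 1
      rw [← one_add_one_eq_two]
      abel
    · refine commutator_mem_of_mem_span fun u hu => ?_
      rcases hu with rfl | rfl | rfl
      · rw [sub_self]
        exact zero_mem _
      · have e1 : (genA n ν 0 - genB n ν 0) * (genA n ν 0 + genB n ν 0) -
            (genA n ν 0 + genB n ν 0) * (genA n ν 0 - genB n ν 0) = 0 := by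
          simp only [mul_sub, sub_mul, mul_add, add_mul, genA_mul_genB_self]
          abel
        rw [e1]
        exact zero_mem _
      · have e1 : (genA n ν 0 - genB n ν 0) * (genA n ν 1 + genB n ν 1) -
            (genA n ν 1 + genB n ν 1) * (genA n ν 0 - genB n ν 0) =
            (genA n ν 0 * genA n ν 1 - genA n ν 1 * genA n ν 0) +
            (genA n ν 0 * genB n ν 1 - genB n ν 1 * genA n ν 0) -
            (genB n ν 0 * genA n ν 1 - genA n ν 1 * genB n ν 0) -
            (genB n ν 0 * genB n ν 1 - genB n ν 1 * genB n ν 0) := by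
          simp only [mul_sub, sub_mul, mul_add, add_mul]
          abel
        have e2 := sub_mem (hX 1) (hX (-1))
        rw [e1, genA_zero_mul_genA_one_sub, genA_zero_mul_genB_one_sub,
          genB_zero_mul_genA_one_sub, genB_zero_mul_genB_one_sub]
        rw [sra_smul_sub, sra_smul_sub] at e2
        convert e2 using 1
        abel
    · intro x hx
      have hfix : genG n ν (reflec n 0) * (genA n ν 0 - genB n ν 0) =
          (genA n ν 0 - genB n ν 0) * genG n ν (reflec n 0) := by
        rw [mul_sub, sub_mul, reflec_zero_mul_genA, reflec_zero_mul_genB]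
        abel
      rw [mul_assoc, h.high _ (sub_mem (genA_mem 0) (genB_mem 0)) _ (mul_genG_mem hx _), one_mul,
        mul_assoc x, hfix, mul_assoc x]
    · rintro y hy _ ⟨l, hl, rfl⟩
      rw [reflec_mul_reflec, sub_zero]
      exact hrot l hl y hy
  refine eq_zero_of_mem_degPart (fun k y hy => ?_) hreflec hy
  -- Only words followed by the identity remain. As `[a^0, b^1] = 1 + μ L_0`, the error terms are
  -- words followed by reflections, which are settled by now.
  by_cases hk : k = 0
  · have hone : rot n k = 1 := by rw [hk]; rfl
    rw [hone]
    have hX : ∀ p, ((n : ℂ) * ν) • imL n ν p ∈ grpSpan ν (Set.range (reflec n)) :=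
      fun p => Submodule.smul_mem _ _ (imL_mem p)
    refine apply_mul_genG_eq_zero (Γ := Set.range (reflec n)) (v := genA n ν 0)
      (c := genB n ν 1) (ω := 1)
      (U := Submodule.span ℂ {genA n ν 0, genA n ν 1, genB n ν 0}) one_ne_zero (genB_mem 1)
      ?_ ?_ ?_ ?_ hlow ?_ ?_ hy
    · rw [Submodule.span_le]
      rintro _ (rfl | rfl | rfl)
      exacts [genA_mem 0, genA_mem 1, genB_mem 0]
    · rw [vecSpan, Submodule.span_le]
      rintro _ (⟨α, rfl⟩ | ⟨α, rfl⟩)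
      · refine Submodule.mem_sup_right (Submodule.subset_span ?_)
        fin_cases α <;> simp
      · fin_cases α
        · exact Submodule.mem_sup_right (Submodule.subset_span (by simp))
        · exact Submodule.mem_sup_left (Submodule.mem_span_singleton_self _)
    · rw [genA_zero_mul_genB_one_sub, map_one, add_sub_cancel_left]
      exact hX 0
    · refine commutator_mem_of_mem_span fun u hu => ?_
      rcases hu with rfl | rfl | rfl
      · rw [sub_self]
        exact zero_mem _
      · rw [genA_zero_mul_genA_one_sub]
        exact hX 1
      · rw [genA_mul_genB_self, sub_self]
        exact zero_mem _
    · intro x hx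
      rw [mul_assoc, h.high _ (genA_mem 0) _ (mul_genG_mem hx _), one_mul, genG_one, mul_one,
        mul_one]
    · rintro y hy _ ⟨l, rfl⟩
      rw [mul_one]
      exact hreflec l y hy
  · exact hrot k hk y hy

/-- A functional that is cyclic with factor `-1` in degree `e` and vanishes in degree `e - 2`
vanishes in degree `e`, provided that it vanishes on the rotations if `e = 0`. -/
theorem IsCyclicAt.eq_zero_of_neg_one {t : SRA n ν →ₗ[ℂ] ℂ} {e : ℕ} (h : IsCyclicAt t (-1) e)
    (hn : Odd n) (hlow : ∀ y ∈ degPart n ν (e - 1), t y = 0)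
    (hS : e = 0 → ∀ k, t (genG n ν (rot n k)) = 0) {y : SRA n ν}
    (hy : y ∈ degPart n ν (e + 1)) : t y = 0 := by
  have hrot : ∀ k, ∀ y ∈ vecSpan n ν ^ e, t (y * genG n ν (rot n k)) = 0 := by
    intro k y hy
    cases e with
    | zero =>
      rw [pow_zero, Submodule.mem_one] at hy
      obtain ⟨s, rfl⟩ := hy
      rw [← Algebra.smul_def, map_smul, hS rfl k, smul_zero]
    | succ e =>
      exact h.apply_mul_rot_eq_zero hlow (neg_one_mul_stdAddChar_ne_one hn _)
        (neg_one_mul_stdAddChar_ne_one hn _) hy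
  refine eq_zero_of_mem_degPart hrot (fun k y hy => ?_) hy
  refine h.apply_mul_reflec_eq_zero hn (fun y hy => ?_) k hy
  have hX : ∀ p, ((n : ℂ) * ν) • imL n ν p ∈ grpSpan ν (Set.range (reflec n)) :=
    fun p => Submodule.smul_mem _ _ (imL_mem p)
  -- `R_0` anticommutes with `a^α + b^α`, and this sign cancels the cyclic factor `-1`. Here all
  -- rotations, the identity included, are already settled, so `R_0` may occur in the commutators.
  refine apply_mul_genG_eq_zero (Γ := Set.range (reflec n)) (v := genA n ν 0 + genB n ν 0)
    (c := genA n ν 1 + genB n ν 1) (ω := 2)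
    (U := Submodule.span ℂ {genA n ν 0 + genB n ν 0, genA n ν 0 - genB n ν 0,
      genA n ν 1 - genB n ν 1}) (by norm_num) (add_mem (genA_mem 1) (genB_mem 1)) ?_ ?_ ?_ ?_
    hlow ?_ ?_ hy
  · rw [Submodule.span_le]
    rintro _ (rfl | rfl | rfl)
    exacts [add_mem (genA_mem 0) (genB_mem 0), sub_mem (genA_mem 0) (genB_mem 0),
      sub_mem (genA_mem 1) (genB_mem 1)]
  · refine vecSpan_le_of_add_sub_mem (fun α => ?_) fun α => ?_
    · fin_cases α
      · exact Submodule.mem_sup_right (Submodule.subset_span (by simp))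
      · exact Submodule.mem_sup_left (Submodule.mem_span_singleton_self _)
    · refine Submodule.mem_sup_right (Submodule.subset_span ?_)
      fin_cases α <;> simp
  · have e1 : (genA n ν 0 + genB n ν 0) * (genA n ν 1 + genB n ν 1) -
        (genA n ν 1 + genB n ν 1) * (genA n ν 0 + genB n ν 0) =
        (genA n ν 0 * genA n ν 1 - genA n ν 1 * genA n ν 0) +
        (genA n ν 0 * genB n ν 1 - genB n ν 1 * genA n ν 0) +
        (genB n ν 0 * genA n ν 1 - genA n ν 1 * genB n ν 0) +
        (genB n ν 0 * genB n ν 1 - genB n ν 1 * genB n ν 0) := by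
      simp only [mul_add, add_mul]
      abel
    have e2 := add_mem (add_mem (hX 1) (hX (-1))) (add_mem (hX 0) (hX 0))
    rw [e1, genA_zero_mul_genA_one_sub, genA_zero_mul_genB_one_sub, genB_zero_mul_genA_one_sub,
      genB_zero_mul_genB_one_sub, map_ofNat]
    convert e2 using 1
    rw [← one_add_one_eq_two]
    abel
  · refine commutator_mem_of_mem_span fun u hu => ?_
    rcases hu with rfl | rfl | rfl
    · rw [sub_self]
      exact zero_mem _
    · have e1 : (genA n ν 0 + genB n ν 0) * (genA n ν 0 - genB n ν 0) -
          (genA n ν 0 - genB n ν 0) * (genA n ν 0 + genB n ν 0) = 0 := by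
        simp only [mul_sub, sub_mul, mul_add, add_mul, genA_mul_genB_self]
        abel
      rw [e1]
      exact zero_mem _
    · have e1 : (genA n ν 0 + genB n ν 0) * (genA n ν 1 - genB n ν 1) -
          (genA n ν 1 - genB n ν 1) * (genA n ν 0 + genB n ν 0) =
          (genA n ν 0 * genA n ν 1 - genA n ν 1 * genA n ν 0) -
          (genA n ν 0 * genB n ν 1 - genB n ν 1 * genA n ν 0) +
          (genB n ν 0 * genA n ν 1 - genA n ν 1 * genB n ν 0) -
          (genB n ν 0 * genB n ν 1 - genB n ν 1 * genB n ν 0) := by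
        simp only [mul_sub, sub_mul, mul_add, add_mul]
        abel
      have e2 := sub_mem (hX 1) (hX (-1))
      rw [e1, genA_zero_mul_genA_one_sub, genA_zero_mul_genB_one_sub,
        genB_zero_mul_genA_one_sub, genB_zero_mul_genB_one_sub]
      convert e2 using 1
      abel
  · intro x hx
    have hfix : genG n ν (reflec n 0) * (genA n ν 0 + genB n ν 0) =
        -((genA n ν 0 + genB n ν 0) * genG n ν (reflec n 0)) := by
      rw [mul_add, add_mul, reflec_zero_mul_genA, reflec_zero_mul_genB]
      abel
    rw [mul_assoc, h.high _ (add_mem (genA_mem 0) (genB_mem 0)) _ (mul_genG_mem hx _),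
      mul_assoc x, hfix, mul_assoc x, sra_mul_neg, map_neg, neg_one_mul, neg_neg]
  · rintro y hy _ ⟨l, rfl⟩
    rw [reflec_mul_reflec, sub_zero]
    exact hrot l y hy

/-- Word length drops by two under commutators, so the induction has that step. For `e = 0` and `e =
1` the truncated index `e - 1` is `0` and the premise is vacuous. -/
theorem eq_zero_of_degPart {t : SRA n ν →ₗ[ℂ] ℂ} (h : ∀ e, (∀ y ∈ degPart n ν (e - 1), t y = 0) →
    ∀ y ∈ degPart n ν (e + 1), t y = 0) : t = 0 := by
  have key : ∀ e, ∀ y ∈ degPart n ν e, t y = 0 := by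
    intro e
    induction e using Nat.strong_induction_on with
    | _ e ih =>
      cases e with
      | zero =>
        intro y hy
        rw [degPart, Submodule.mem_bot] at hy
        rw [hy, map_zero]
      | succ e => exact h e (ih (e - 1) (by omega))
  ext x
  have hx := mem_iSup_degPart x
  induction hx using Submodule.iSup_induction' with
  | mem e y hy => exact key e y hy
  | zero => simp
  | add x y _ _ hx hy => rw [map_add, hx, hy, map_add]

/-- A trace is determined by its values on the nontrivial rotations. -/
theorem IsTrace.eq_zero {t : SRA n ν →ₗ[ℂ] ℂ} (ht : IsTrace t) (hn : Odd n)
    (hS : ∀ k ≠ 0, t (S n ν k) = 0) : t = 0 := by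
  have hcomm : ∀ f g, t (f * g) = t (g * f) := fun f g => by
    rw [← sub_eq_zero, ← map_sub]
    exact ht f g
  refine eq_zero_of_degPart fun e hlow y hy => ?_
  refine IsCyclicAt.eq_zero_of_one ⟨?_, ?_, ?_⟩ hn hlow (fun _ => hS) hy
  · intro v _ y _
    rw [hcomm, one_mul]
  · intro v _ y _
    rw [hcomm, one_mul]
  · intro g y _
    rw [hcomm, ← mul_assoc, genG_inv_mul, one_mul]

theorem genG_mem_parityPart (g : DihedralGroup n) : genG n ν g ∈ parityPart n ν 0 :=
  Submodule.subset_span ⟨[Gen.grp g], by simp [Gen.parity], by simp [genG]⟩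

theorem vecSpan_le_parityPart : vecSpan n ν ≤ parityPart n ν 1 := by
  rw [vecSpan, Submodule.span_le]
  rintro _ (⟨α, rfl⟩ | ⟨α, rfl⟩)
  · exact Submodule.subset_span ⟨[Gen.a α], by simp [Gen.parity], by simp [genA]⟩
  · exact Submodule.subset_span ⟨[Gen.b α], by simp [Gen.parity], by simp [genB]⟩

theorem degPart_le_parityPart (e : ℕ) : degPart n ν e ≤ parityPart n ν (e + 1 : ℕ) := by
  induction e with
  | zero => simp [degPart]
  | succ e ih =>
    cases e with
    | zero =>
      rw [degPart, pow_zero, one_mul, grpSpan, Submodule.span_le]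
      rintro _ ⟨g, -, rfl⟩
      exact genG_mem_parityPart g
    | succ e =>
      rw [degPart, pow_succ', mul_assoc, Submodule.mul_le]
      intro v hv y hy
      have := mul_mem_parityPart (vecSpan_le_parityPart hv) (ih hy)
      convert this using 2
      push_cast
      ring

/-- A supertrace is determined by its values on the rotations. -/
theorem IsSupertrace.eq_zero {t : SRA n ν →ₗ[ℂ] ℂ} (ht : IsSupertrace t) (hn : Odd n)
    (hS : ∀ k, t (S n ν k) = 0) : t = 0 := by
  have hcomm : ∀ (i j : ZMod 2), ∀ f ∈ parityPart n ν i, ∀ g ∈ parityPart n ν j,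
      t (f * g) = (-1) ^ (i.val * j.val) * t (g * f) := fun i j f hf g hg => by
    have h := ht i j f hf g hg
    rwa [map_sub, map_smul, smul_eq_mul, sub_eq_zero] at h
  have hodd : ∀ (e : ℕ), ∀ v ∈ vecSpan n ν, ∀ y ∈ degPart n ν e,
      t (v * y) = (-1) ^ (e + 1) * t (y * v) := fun e v hv y hy => by
    rw [hcomm 1 _ v (vecSpan_le_parityPart hv) y (degPart_le_parityPart e hy), ZMod.val_one,
      one_mul, ZMod.val_natCast, ← neg_one_pow_eq_pow_mod_two]
  refine eq_zero_of_degPart fun e hlow y hy => ?_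
  -- The letter moved is odd and the rest consists of `e - 1` or `e + 1` letters, which gives the
  -- sign `(-1)^(e+1)` in both cases. So even lengths fall under the factor `-1`, odd ones under
  -- `1`, and initial values are needed only on rotations, at `e = 0`.
  have hcyc : IsCyclicAt t ((-1) ^ (e + 1)) e := by
    refine ⟨hodd e, fun v hv y hy => ?_, fun g y hy => ?_⟩
    · rw [hodd (e + 2) v hv y hy]
      ring
    · rw [mul_assoc, hcomm 0 _ _ (genG_mem_parityPart g) _
        (degPart_le_parityPart _ (degPart_mul_genG_mem hy _)), ZMod.val_zero, zero_mul, pow_zero,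
        one_mul, mul_assoc, genG_inv_mul, mul_one]
  rcases Nat.even_or_odd e with he | he
  · rw [he.add_one.neg_one_pow] at hcyc
    exact hcyc.eq_zero_of_neg_one hn hlow (fun _ => hS) hy
  · rw [he.add_one.neg_one_pow] at hcyc
    refine hcyc.eq_zero_of_one hn hlow (fun h0 => ?_) hy
    rw [h0] at he
    exact absurd he (by decide)

end

end DihedralSRA

/-! ### Values on rotations and comparison of the two forms -/

namespace DihedralSRA

noncomputable section

variable {n : ℕ} [NeZero n] {ν : ℂ}

theorem exp_factor_sin (θ : ℂ) :
    (1 - Complex.exp (-(2 * θ) * Complex.I)) * (1 - (Complex.exp (-(2 * θ) * Complex.I))⁻¹) =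
      4 * Complex.sin θ ^ 2 := by
  have h1 := Complex.two_cos (2 * θ)
  have h2 : (Complex.exp (-(2 * θ) * Complex.I))⁻¹ = Complex.exp (2 * θ * Complex.I) := by
    rw [← Complex.exp_neg]
    ring_nf
  have h3 : Complex.exp (-(2 * θ) * Complex.I) * Complex.exp (2 * θ * Complex.I) = 1 := by
    rw [← Complex.exp_add]
    simp
  rw [Complex.cos_two_mul] at h1
  rw [h2]
  linear_combination h3 + h1 - 4 * Complex.sin_sq_add_cos_sq θ

theorem exp_factor_cos (θ : ℂ) :
    (1 + Complex.exp (-(2 * θ) * Complex.I)) * (1 + (Complex.exp (-(2 * θ) * Complex.I))⁻¹) =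
      4 * Complex.cos θ ^ 2 := by
  have h1 := Complex.two_cos (2 * θ)
  have h2 : (Complex.exp (-(2 * θ) * Complex.I))⁻¹ = Complex.exp (2 * θ * Complex.I) := by
    rw [← Complex.exp_neg]
    ring_nf
  have h3 : Complex.exp (-(2 * θ) * Complex.I) * Complex.exp (2 * θ * Complex.I) = 1 := by
    rw [← Complex.exp_add]
    simp
  rw [Complex.cos_two_mul] at h1
  rw [h2]
  linear_combination h3 - h1

/-- The product of the sign-twisted factors of degree `N`; here `s = 1` or `s = -1`. -/
theorem exp_factor_pow {s : ℂ} (hs : s * s = 1) (θ : ℂ) (N : ℕ) :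
    (1 - (s * Complex.exp (-(2 * θ) * Complex.I)) ^ N) *
      (1 - (s * Complex.exp (-(2 * θ) * Complex.I))⁻¹ ^ N) =
      2 * (1 - s ^ N * Complex.cos (N * (2 * θ))) := by
  have h1 := Complex.two_cos (N * (2 * θ))
  have hs' : s⁻¹ = s := inv_eq_of_mul_eq_one_left hs
  have hsN : s ^ N * s ^ N = 1 := by rw [← mul_pow, hs, one_pow]
  have h2 : (Complex.exp (-(2 * θ) * Complex.I))⁻¹ ^ N =
      Complex.exp (N * (2 * θ) * Complex.I) := by
    rw [← Complex.exp_neg, ← Complex.exp_nat_mul]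
    ring_nf
  have h4 : Complex.exp (-(2 * θ) * Complex.I) ^ N = Complex.exp (-(N * (2 * θ)) * Complex.I) := by
    rw [← Complex.exp_nat_mul]
    ring_nf
  have h3 : Complex.exp (-(N * (2 * θ)) * Complex.I) * Complex.exp (N * (2 * θ) * Complex.I) =
      1 := by
    rw [← Complex.exp_add]
    simp
  rw [mul_inv, hs', mul_pow, mul_pow, h2, h4]
  linear_combination s ^ N * s ^ N * h3 + hsN + s ^ N * h1

theorem stdAddChar_neg_natCast (k : ℕ) : (ZMod.stdAddChar (-(k : ZMod n)) : ℂ) =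
    Complex.exp (-(2 * (Real.pi * k / n)) * Complex.I) := by
  have h := ZMod.stdAddChar_coe (N := n) (-(k : ℤ))
  push_cast at h
  rw [h]
  congr 1
  ring

section

variable {N : ℕ} {hn : 3 ≤ n} {hN : (N : ZMod n) ≠ 0} {σ : ℂ} {hσ : σ * σ = 1}
  {hν : n * ν = -(σ * N)}

theorem stdAddChar_neg_mul_intCast (k : ZMod n) (d : ℤ) :
    (ZMod.stdAddChar (-(k * (d : ZMod n))) : ℂ) = ZMod.stdAddChar (-k) ^ d := by
  rw [← AddChar.map_zsmul_eq_zpow, zsmul_eq_mul]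
  congr 1
  ring

theorem siteTrace_S_mul (k : ℕ) : siteTrace hn hN hσ hν (S n ν k) *
    (2 * Complex.sin (Real.pi * k / n) ^ 2) =
      1 - Complex.cos (N * (2 * (Real.pi * k / n))) := by
  have h0 : (ZMod.stdAddChar (-(k : ZMod n)) : ℂ) ≠ 0 := by
    rw [stdAddChar_neg_natCast]
    exact Complex.exp_ne_zero _
  have h := sum_sites_zpow_mul N h0
  have h2 := exp_factor_pow (s := 1) (one_mul 1) (Real.pi * k / n) N
  rw [siteTrace_apply, siteRep_S, trace_lmul_pi]
  simp only [stdAddChar_neg_mul_intCast]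
  simp only [one_mul, one_pow] at h2
  rw [stdAddChar_neg_natCast] at h ⊢
  rw [exp_factor_sin, h2] at h
  linear_combination (1 / 2 : ℂ) * h

theorem siteSupertrace_S_mul (k : ℕ) : siteSupertrace hn hN hσ hν (S n ν k) *
    (2 * Complex.cos (Real.pi * k / n) ^ 2) =
      1 - (-1) ^ N * Complex.cos (N * (2 * (Real.pi * k / n))) := by
  have h0 : -1 * (ZMod.stdAddChar (-(k : ZMod n)) : ℂ) ≠ 0 := by
    rw [stdAddChar_neg_natCast]
    exact mul_ne_zero (by norm_num) (Complex.exp_ne_zero _)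
  have h := sum_sites_zpow_mul N h0
  have h2 := exp_factor_pow (s := -1) (by norm_num) (Real.pi * k / n) N
  have h3 : ∀ w : ℂ, (1 - -1 * w) * (1 - (-1 * w)⁻¹) = (1 + w) * (1 + w⁻¹) := fun w => by
    rw [mul_inv, inv_neg, inv_one]
    ring
  rw [siteSupertrace_apply, siteRep_S, siteParity, ← map_mul, trace_lmul_pi]
  simp only [Pi.mul_apply, stdAddChar_neg_mul_intCast, ← mul_zpow]
  rw [stdAddChar_neg_natCast] at h ⊢
  rw [h3, exp_factor_cos, h2] at h
  linear_combination (1 / 2 : ℂ) * h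

/-- With `κ` acting as the parity operator, the two forms differ by right multiplication of the
second argument by `κ`, which is reversible in the representation because the parity operator is an
involution. -/
theorem siteTrace_siteSupertrace_forms (x : SRA n ν) :
    (∀ y, siteTrace hn hN hσ hν (x * y) = 0) ↔ ∀ y, siteSupertrace hn hN hσ hν (x * y) = 0 := by
  obtain ⟨κ, hκ⟩ := exists_siteRep_eq_siteParity (hn := hn) (hN := hN) (hσ := hσ) (hν := hν)
  have h1 : ∀ y, siteSupertrace hn hN hσ hν (x * y) = siteTrace hn hN hσ hν (x * (y * κ)) := by
    intro y
    rw [siteSupertrace_apply, siteTrace_apply, ← mul_assoc, map_mul (siteRep hn hN hσ hν) (x * y) κ,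
      hκ, LinearMap.trace_mul_comm]
  have h2 : ∀ y, siteTrace hn hN hσ hν (x * y) = siteSupertrace hn hN hσ hν (x * (y * κ)) := by
    intro y
    rw [siteSupertrace_apply, siteTrace_apply, ← mul_assoc, map_mul (siteRep hn hN hσ hν) (x * y) κ,
      hκ, LinearMap.trace_mul_comm, mul_assoc, siteParity_mul_self, mul_one]
  exact ⟨fun h y => by rw [h1, h], fun h y => by rw [h2, h]⟩

end

theorem IsTrace.apply_mul_comm {t : SRA n ν →ₗ[ℂ] ℂ} (ht : IsTrace t) (f g : SRA n ν) :
    t (f * g) = t (g * f) := by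
  rw [← sub_eq_zero, ← map_sub]
  exact ht f g

theorem IsTrace.sub_smul {t s : SRA n ν →ₗ[ℂ] ℂ} (ht : IsTrace t) (hs : IsTrace s) (c : ℂ) :
    IsTrace (t - c • s) := by
  intro f g
  rw [LinearMap.sub_apply, LinearMap.smul_apply, ht, hs, smul_zero, sub_zero]

theorem IsSupertrace.sub_smul {t s : SRA n ν →ₗ[ℂ] ℂ} (ht : IsSupertrace t)
    (hs : IsSupertrace s) (c : ℂ) : IsSupertrace (t - c • s) := by
  intro i j f hf g hg
  rw [LinearMap.sub_apply, LinearMap.smul_apply, ht i j f hf g hg, hs i j f hf g hg, smul_zero,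
    sub_zero]

/-- Traces and supertraces are invariant under conjugation by the even element `R_0`, so the values
on `S_k` with `k ≤ m` determine those on all rotations. -/
theorem S_neg (k : ZMod n) :
    S n ν (-k) = genG n ν (reflec n 0) * (S n ν k * genG n ν (reflec n 0)) := by
  change genG n ν (rot n (-k)) = _ * (genG n ν (rot n k) * _)
  rw [genG_mul, genG_mul, rot_mul_reflec, reflec_mul_reflec]
  congr 2
  ring

theorem reflec_zero_mul_self : genG n ν (reflec n 0) * genG n ν (reflec n 0) = 1 := by
  rw [genG_mul, reflec_mul_reflec, sub_zero, ← genG_one]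
  rfl

theorem IsTrace.apply_S_neg {t : SRA n ν →ₗ[ℂ] ℂ} (ht : IsTrace t) (k : ZMod n) :
    t (S n ν (-k)) = t (S n ν k) := by
  rw [S_neg, ht.apply_mul_comm, mul_assoc, reflec_zero_mul_self, mul_one]

theorem IsSupertrace.apply_S_neg {t : SRA n ν →ₗ[ℂ] ℂ} (ht : IsSupertrace t) (k : ZMod n) :
    t (S n ν (-k)) = t (S n ν k) := by
  have hmem : S n ν k * genG n ν (reflec n 0) ∈ parityPart n ν (0 + 0) :=
    mul_mem_parityPart (genG_mem_parityPart (rot n k)) (genG_mem_parityPart (reflec n 0))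
  have h := ht 0 0 _ (genG_mem_parityPart (reflec n 0)) _ hmem
  rw [ZMod.val_zero, zero_mul, pow_zero, one_smul, map_sub, mul_assoc, reflec_zero_mul_self,
    mul_one, sub_eq_zero] at h
  rw [S_neg]
  exact h

theorem exists_natCast_eq_or_eq_neg (m : ℕ) (k : ZMod (2 * m + 1)) :
    ∃ j : ℕ, j ≤ m ∧ (k = j ∨ k = -j) := by
  by_cases h : k.val ≤ m
  · exact ⟨k.val, h, Or.inl (ZMod.natCast_zmod_val k).symm⟩
  · have hk := ZMod.val_lt k
    refine ⟨2 * m + 1 - k.val, by omega, Or.inr ?_⟩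
    rw [Nat.cast_sub hk.le, ZMod.natCast_self, ZMod.natCast_zmod_val, zero_sub, neg_neg]

theorem sin_ne_zero_of_stdAddChar {k : ℕ} (hk : (k : ZMod n) ≠ 0) :
    Complex.sin (Real.pi * k / n) ≠ 0 := by
  intro h
  have h1 := exp_factor_sin (Real.pi * k / n)
  have h2 := stdAddChar_ne_one (neg_ne_zero.mpr hk)
  rw [stdAddChar_neg_natCast] at h2
  rw [h, zero_pow two_ne_zero, mul_zero, mul_eq_zero, sub_eq_zero, sub_eq_zero, eq_comm,
    eq_comm (a := (1 : ℂ)), inv_eq_one, or_self] at h1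
  exact h2 h1

/-- A zero of the cosine would make `-1` an `n`-th root of unity, which is impossible for odd `n`.
-/
theorem cos_ne_zero_of_odd (hn : Odd n) (k : ℕ) : Complex.cos (Real.pi * k / n) ≠ 0 := by
  intro h
  have h1 := exp_factor_cos (Real.pi * k / n)
  have h2 := neg_one_mul_stdAddChar_ne_one hn (-(k : ZMod n))
  rw [stdAddChar_neg_natCast] at h2
  rw [h, zero_pow two_ne_zero, mul_zero, mul_eq_zero] at h1
  refine h2 ?_
  rcases h1 with h1 | h1
  · linear_combination -h1
  · have h3 := mul_inv_cancel₀ (Complex.exp_ne_zero (-(2 * (Real.pi * k / n)) * Complex.I))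
    linear_combination -Complex.exp (-(2 * (Real.pi * k / n)) * Complex.I) * h1 + h3

omit [NeZero n] in
theorem natCast_natAbs_ne_zero {z : ℤ} (hz : ¬ (n : ℤ) ∣ z) : (z.natAbs : ZMod n) ≠ 0 := by
  rw [Ne, ZMod.natCast_eq_zero_iff]
  exact fun h => hz (Int.natCast_dvd.mpr h)

theorem sign_mul_natAbs (z : ℤ) : (z.sign : ℂ) * (z.natAbs : ℂ) = z := by
  have h := Int.sign_mul_natAbs z
  rw [← Int.cast_natCast, ← Int.cast_mul, h]

theorem cos_natAbs_mul (z : ℤ) (x : ℂ) : Complex.cos (z.natAbs * x) = Complex.cos (z * x) := by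
  rcases Int.natAbs_eq z with h | h
  · conv_rhs => rw [h]
    simp
  · conv_rhs => rw [h]
    simp [Complex.cos_neg]

theorem neg_one_pow_natAbs (z : ℤ) : (-1 : ℂ) ^ z.natAbs = (-1) ^ z := by
  rcases Int.natAbs_eq z with h | h
  · conv_rhs => rw [h, zpow_natCast]
  · conv_rhs => rw [h, zpow_neg, zpow_natCast, ← inv_pow]
    norm_num

variable {m : ℕ} {z : ℤ} {hn : 3 ≤ 2 * m + 1} {hN : (z.natAbs : ZMod (2 * m + 1)) ≠ 0}
  {σ : ℂ} {hσ : σ * σ = 1} {hν : (2 * m + 1 : ℕ) * ν = -(σ * z.natAbs)}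

/-- The trace `tr_z` is proportional to the character of the finite-dimensional representation. -/
theorem IsTrZ.eq_smul {τ : ℂ} {tr : SRA (2 * m + 1) ν →ₗ[ℂ] ℂ} (h : IsTrZ m z τ ν tr) :
    tr = (2 * τ / (2 * m + 1 : ℕ)) • siteTrace hn hN hσ hν := by
  have hd := h.1.sub_smul (isTrace_siteTrace (hn := hn) (hN := hN) (hσ := hσ) (hν := hν))
    (2 * τ / (2 * m + 1 : ℕ))
  refine sub_eq_zero.mp (hd.eq_zero ⟨m, rfl⟩ ?_)
  have hnat : ∀ k : ℕ, k ≤ m → (k : ZMod (2 * m + 1)) ≠ 0 →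
      (tr - (2 * τ / (2 * m + 1 : ℕ)) • siteTrace hn hN hσ hν) (S (2 * m + 1) ν k) = 0 := by
    intro k hk hk0
    have hk1 : 1 ≤ k := Nat.one_le_iff_ne_zero.mpr fun h0 => hk0 (by rw [h0, Nat.cast_zero])
    have e1 := siteTrace_S_mul (hn := hn) (hN := hN) (hσ := hσ) (hν := hν) k
    have hs := sin_ne_zero_of_stdAddChar hk0
    have hn0 : ((2 * m + 1 : ℕ) : ℂ) ≠ 0 := Nat.cast_ne_zero.mpr (by omega)
    rw [cos_natAbs_mul] at e1
    rw [LinearMap.sub_apply, LinearMap.smul_apply, h.2 k hk1 hk, smul_eq_mul, sub_eq_zero]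
    rw [show 2 * (Real.pi : ℂ) * k * z / (2 * m + 1) =
      z * (2 * (Real.pi * k / (2 * m + 1 : ℕ))) by push_cast; ring, ← e1]
    push_cast at hs hn0 ⊢
    field_simp
  intro k hk
  obtain ⟨j, hj, rfl | rfl⟩ := exists_natCast_eq_or_eq_neg m k
  · exact hnat j hj hk
  · rw [hd.apply_S_neg]
    exact hnat j hj (neg_ne_zero.mp hk)

/-- The supertrace `str_z` is proportional to the supercharacter of the finite-dimensional
representation. -/
theorem IsStrZ.eq_smul {τ : ℂ} {str : SRA (2 * m + 1) ν →ₗ[ℂ] ℂ} (h : IsStrZ m z τ ν str) :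
    str = (2 * τ / (2 * m + 1 : ℕ)) • siteSupertrace hn hN hσ hν := by
  have hd := h.1.sub_smul (isSupertrace_siteSupertrace (hn := hn) (hN := hN) (hσ := hσ) (hν := hν))
    (2 * τ / (2 * m + 1 : ℕ))
  refine sub_eq_zero.mp (hd.eq_zero ⟨m, rfl⟩ ?_)
  have hnat : ∀ k : ℕ, k ≤ m →
      (str - (2 * τ / (2 * m + 1 : ℕ)) • siteSupertrace hn hN hσ hν) (S (2 * m + 1) ν k) = 0 := by
    intro k hk
    have e1 := siteSupertrace_S_mul (hn := hn) (hN := hN) (hσ := hσ) (hν := hν) k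
    have hs := cos_ne_zero_of_odd (n := 2 * m + 1) ⟨m, rfl⟩ k
    have hn0 : ((2 * m + 1 : ℕ) : ℂ) ≠ 0 := Nat.cast_ne_zero.mpr (by omega)
    rw [cos_natAbs_mul, neg_one_pow_natAbs] at e1
    rw [LinearMap.sub_apply, LinearMap.smul_apply, h.2 k hk, smul_eq_mul, sub_eq_zero]
    rw [show 2 * (Real.pi : ℂ) * k * z / (2 * m + 1) =
      z * (2 * (Real.pi * k / (2 * m + 1 : ℕ))) by push_cast; ring, ← e1]
    push_cast at hs hn0 ⊢
    field_simp
  intro k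
  obtain ⟨j, hj, rfl | rfl⟩ := exists_natCast_eq_or_eq_neg m k
  · exact hnat j hj
  · rw [hd.apply_S_neg]
    exact hnat j hj

theorem mem_formKernel_smul {c : ℂ} (hc : c ≠ 0) (t : SRA n ν →ₗ[ℂ] ℂ) (x : SRA n ν) :
    x ∈ formKernel (c • t) ↔ ∀ y, t (x * y) = 0 := by
  rw [mem_formKernel]
  simp only [LinearMap.smul_apply, smul_eq_mul, mul_eq_zero, hc, false_or]

/-- The kernel of the form of a trace, as a two-sided ideal. -/
def IsTrace.kernelIdeal {t : SRA n ν →ₗ[ℂ] ℂ} (ht : IsTrace t) : TwoSidedIdeal (SRA n ν) :=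
  TwoSidedIdeal.mk' (formKernel t) (zero_mem _) (fun hx hy => add_mem hx hy)
    (fun hx => neg_mem hx)
    (fun {x y} hy => by
      rw [SetLike.mem_coe, mem_formKernel] at hy ⊢
      intro w
      -- The left factor is carried around by cyclicity: `t(x y w) = t(y w x) = 0`.
      rw [mul_assoc, ht.apply_mul_comm, mul_assoc, hy])
    (fun {x y} hx => by
      rw [SetLike.mem_coe, mem_formKernel] at hx ⊢
      intro w
      rw [mul_assoc, hx])

theorem IsTrace.mem_kernelIdeal {t : SRA n ν →ₗ[ℂ] ℂ} (ht : IsTrace t) (x : SRA n ν) :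
    x ∈ ht.kernelIdeal ↔ x ∈ formKernel t :=
  TwoSidedIdeal.mem_mk' _ _ _ _ _ _ _

end

end DihedralSRA

/-- For `ν = z/n`, `n = 2m+1`, `z ∈ ℤ ∖ nℤ`, the kernels of the forms of `tr_z` and `str_z` on
`H_{1,ν}(I₂(n))` are one and the same two-sided ideal. -/
theorem mainTheorem1 (m : ℕ) (hm : 1 ≤ m) (z : ℤ) (hz : ¬ ((2 * m + 1 : ℕ) : ℤ) ∣ z)
    (ν : ℂ) (hν : ν = (z : ℂ) / (2 * m + 1))
    (τ τ' : ℂ) (hτ : τ ≠ 0) (hτ' : τ' ≠ 0)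
    (tr str : DihedralSRA.SRA (2 * m + 1) ν →ₗ[ℂ] ℂ)
    (htr : DihedralSRA.IsTrZ m z τ ν tr) (hstr : DihedralSRA.IsStrZ m z τ' ν str) :
    DihedralSRA.formKernel tr = DihedralSRA.formKernel str ∧
      ∃ I : TwoSidedIdeal (DihedralSRA.SRA (2 * m + 1) ν),
        (∀ x, x ∈ I ↔ x ∈ DihedralSRA.formKernel tr) ∧
        (∀ x, x ∈ I ↔ x ∈ DihedralSRA.formKernel str) := by
  have hn0 : ((2 * m + 1 : ℕ) : ℂ) ≠ 0 := Nat.cast_ne_zero.mpr (by omega)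
  -- The representation requires `n ν = -σ N` with `N` a natural number. As `n ν = z`, this forces
  -- `N = |z|` and `σ = -sign z`.
  have hσ : (-(z.sign : ℂ)) * -(z.sign : ℂ) = 1 := by
    have hz0 : z ≠ 0 := fun h => hz (h ▸ dvd_zero _)
    rw [neg_mul_neg]
    rcases lt_or_gt_of_ne hz0 with h | h
    · rw [Int.sign_eq_neg_one_of_neg h]
      norm_num
    · rw [Int.sign_eq_one_of_pos h]
      norm_num
  have hν' : ((2 * m + 1 : ℕ) : ℂ) * ν = -(-(z.sign : ℂ) * z.natAbs) := by
    rw [neg_mul, neg_neg, DihedralSRA.sign_mul_natAbs, hν]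
    push_cast at hn0 ⊢
    field_simp
  have hN := DihedralSRA.natCast_natAbs_ne_zero hz
  have h1 := htr.eq_smul (hn := by omega) (hN := hN) (hσ := hσ) (hν := hν')
  have h2 := hstr.eq_smul (hn := by omega) (hN := hN) (hσ := hσ) (hν := hν')
  have hker : DihedralSRA.formKernel tr = DihedralSRA.formKernel str := by
    ext x
    rw [h1, h2, DihedralSRA.mem_formKernel_smul (div_ne_zero (mul_ne_zero two_ne_zero hτ) hn0),
      DihedralSRA.mem_formKernel_smul (div_ne_zero (mul_ne_zero two_ne_zero hτ') hn0),
      DihedralSRA.siteTrace_siteSupertrace_forms]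
  exact ⟨hker, htr.1.kernelIdeal, htr.1.mem_kernelIdeal, fun x => by
    rw [← hker, htr.1.mem_kernelIdeal]⟩
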